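/- Let $q=2^n>2$. In $PG(3,q)$, an ovoid is a set of $q^2+1$ points, no three collinear; a line is tangent, secant or disjoint to a point set if it meets it in exactly one, exactly two or no points. A general linear complex is the set of all absolute lines of a symplectic polarity of $PG(3,q)$ (a polarity for which all points are absolute). A regulus is the set of all transversals (lines meeting each) of three mutually skew lines; any three mutually skew lines lie in a unique regulus. A spread is a set of $q^2+1$ mutually skew lines, and it is regular if it contains the regulus through any three of its lines. Let $\{\theta_i\}_{i=0}^{q}$ be an ovoidal fibration of $PG(3,q)$, that is, $q+1$ ovoids that partition the point set, and let $\mathcal L_i$ be the set of all tangent lines to $\theta_i$, $0\le i\le q$. Then: (i) The set $\mathcal S$ of common tangent lines to the ovoids $\theta_i$ is a regular spread of $PG(3,q)$. Further, $\mathcal L_0,\dots,\mathcal L_q$ are general linear complexes, they are the only general linear complexes of $PG(3,q)$ containing $\mathcal S$, and $\mathcal L_i\cap\mathcal L_j=\mathcal S$ for all $0\le i\ne j\le q$. (ii) Each line $\ell$ of $PG(3,q)$ not in $\mathcal S$ is tangent to a unique ovoid $\theta_i$, secant to exactly $q/2$ of the ovoids $\theta_j$, $j\neq i$, and disjoint from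 each of the remaining $q/2$ ovoids $\theta_k$ of the fibration. -/

import Mathlib

/-! Projective 3-space `PG(3,q)` is the geometry of subspaces of a vector space `V` of dimension 4
over a field `K` with `q` elements: points are the elements of `Projectivization K V`,
lines are the subspaces of dimension 2. -/

namespace PG3

/-- The lines of the projective space on `V`: the two-dimensional subspaces. -/
abbrev Line (K V : Type*) [Field K] [AddCommGroup V] [Module K V] : Type _ :=
  {W : Submodule K V // Module.finrank K W = 2}

section

variable {K V : Type*} [Field K] [AddCommGroup V] [Module K V]

/-- The set of points on a line. -/
def Line.points (ℓ : Line K V) : Set (Projectivization K V) :=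
  {p | p.submodule ≤ ℓ.1}

/-- Two lines meet if they have a common point. -/
def Meets (ℓ m : Line K V) : Prop := (ℓ.points ∩ m.points).Nonempty

/-- Two lines are skew if they have no common point. -/
def Skew (ℓ m : Line K V) : Prop := Disjoint ℓ.points m.points

/-- An ovoid: a set of `q ^ 2 + 1` points, no three of which are collinear. -/
def IsOvoid (θ : Set (Projectivization K V)) : Prop :=
  θ.ncard = Nat.card K ^ 2 + 1 ∧
  ∀ x ∈ θ, ∀ y ∈ θ, ∀ z ∈ θ, x ≠ y → x ≠ z → y ≠ z →
    ¬ ∃ ℓ : Line K V, x ∈ ℓ.points ∧ y ∈ ℓ.points ∧ z ∈ ℓ.points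

/-- A line is tangent to a point set if it meets it in exactly one point. -/
def IsTangent (ℓ : Line K V) (θ : Set (Projectivization K V)) : Prop :=
  (ℓ.points ∩ θ).ncard = 1

/-- A line is secant to a point set if it meets it in exactly two points. -/
def IsSecant (ℓ : Line K V) (θ : Set (Projectivization K V)) : Prop :=
  (ℓ.points ∩ θ).ncard = 2

/-- The set of all tangent lines to a point set. -/
def tangentLines (θ : Set (Projectivization K V)) : Set (Line K V) :=
  {ℓ | IsTangent ℓ θ}

/-- The set of lines that are tangent to every member of a family of point sets. -/
def commonTangents {ι : Type*} (θ : ι → Set (Projectivization K V)) : Set (Line K V) :=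
  {ℓ | ∀ i, IsTangent ℓ (θ i)}

/-- An ovoidal fibration: `q + 1` ovoids that partition the point set. -/
structure IsOvoidalFibration (θ : Fin (Nat.card K + 1) → Set (Projectivization K V)) : Prop where
  isOvoid : ∀ i, IsOvoid (θ i)
  disjoint : ∀ i j, i ≠ j → Disjoint (θ i) (θ j)
  cover : ⋃ i, θ i = Set.univ

/-- A symplectic polarity: an inclusion-reversing map of order two on the subspaces (a polarity)
for which every point is absolute, that is, incident with its image. -/
structure IsSymplecticPolarity (π : Submodule K V → Submodule K V) : Prop where
  antitone : Antitone π
  involutive : Function.Involutive π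
  absolute : ∀ p : Projectivization K V, p.submodule ≤ π p.submodule

/-- A general linear complex: the set of all absolute lines of a symplectic polarity. -/
def IsGeneralLinearComplex (L : Set (Line K V)) : Prop :=
  ∃ π : Submodule K V → Submodule K V,
    IsSymplecticPolarity π ∧ L = {ℓ : Line K V | ℓ.1 ≤ π ℓ.1}

/-- A regulus: the set of all transversals of three mutually skew lines. -/
def IsRegulus (R : Set (Line K V)) : Prop :=
  ∃ a b c : Line K V, Skew a b ∧ Skew a c ∧ Skew b c ∧
    R = {t | Meets t a ∧ Meets t b ∧ Meets t c}

/-- A spread: a set of `q ^ 2 + 1` mutually skew lines. -/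
def IsSpread (S : Set (Line K V)) : Prop :=
  S.ncard = Nat.card K ^ 2 + 1 ∧ ∀ ℓ ∈ S, ∀ m ∈ S, ℓ ≠ m → Skew ℓ m

/-- A regular spread: a spread that contains the regulus through any three of its lines. -/
def IsRegularSpread (S : Set (Line K V)) : Prop :=
  IsSpread S ∧
  ∀ a ∈ S, ∀ b ∈ S, ∀ c ∈ S, a ≠ b → a ≠ c → b ≠ c →
    ∀ R : Set (Line K V), IsRegulus R → a ∈ R → b ∈ R → c ∈ R → R ⊆ S

end

end PG3

open PG3

/-! Let `q` be the order of `K`. The plan is to show that the tangents of an ovoid through any point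
`X` are the lines through `X` in a plane `H X`, to obtain a symplectic polarity from `X ↦ H X`, and
then to compare the `q + 1` planes `H i X` that belong to the ovoids of the fibration.

*Tangents of one ovoid.* Counting shows that every tangent lies in a plane with `q + 1` points of
the ovoid. As `q` is even, the tangents in such a plane are concurrent in a nucleus `N`
(`IsCap.exists_nucleus`). A plane on `N` meets the plane of the nucleus in a tangent, so it has at
most `q + 1` points; if `N` is on a secant this forces all planes on that secant to have exactly
`q + 1` points (`IsNucleus.card_le_of_secant`). If `N` were on no secant, it could be added to the
ovoid, but a cap has at most `q ^ 2 + 1` points (`IsCap.ncard_le`, which needs `q > 2`). Hence the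
planes on `N` have `1` or `q + 1` points, and each tangent lies on exactly one plane with one point
and on `q` planes with `q + 1` points. The former is the plane of the tangents at the point of
contact; the nuclei of the latter are different, so they are the other points of the tangent
(`IsCap.exists_tangent_plane`).

*The fibration.* Each line has `q + 1` points, an odd number, so it is tangent to some ovoid of the
fibration. Hence for each `X` the planes `H i X` cover the space. A cover by `q + 1` planes is the
pencil of planes on a line (`cover_unique`), which is here the unique common tangent through `X`;
every other line through `X` is tangent to one ovoid only. This gives the spread and the numbers of
secant and disjoint ovoids. The polar plane of `X` in any general linear complex that contains the
spread is `H i X` for some `i`, and this `i` does not depend on `X`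
(`IsTangentSystem.eq_tangentLines`).

*Regularity.* The `q + 1` polars of a transversal `t` of three spread lines are all the transversals
of these lines, and a spread line that meets `t` meets all polars of `t`
(`IsTangentSystem.meets_transversal`). So the regulus consists of spread lines. -/

namespace PG3

/-! ### Incidence and counting in the lattice of subspaces -/

section Incidence

variable {K V : Type*} [Field K] [AddCommGroup V] [Module K V]

theorem eq_of_submodule_le {p r : Projectivization K V} (h : p.submodule ≤ r.submodule) :
    p = r := by
  have : FiniteDimensional K r.submodule :=
    Module.finite_of_finrank_pos (by rw [r.finrank_submodule]; exact one_pos)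
  exact Projectivization.submodule_injective
    (Submodule.eq_of_le_of_finrank_eq h (by rw [p.finrank_submodule, r.finrank_submodule]))

theorem exists_point_of_mem {v : V} (hv : v ≠ 0) :
    ∃ p : Projectivization K V, v ∈ p.submodule ∧
      ∀ W : Submodule K V, p.submodule ≤ W ↔ v ∈ W := by
  refine ⟨Projectivization.mk K v hv, ?_, fun W => ?_⟩
  · rw [Projectivization.submodule_mk]; exact Submodule.mem_span_singleton_self v
  · rw [Projectivization.submodule_mk, Submodule.span_singleton_le_iff_mem]

theorem point_le_iff (p : Projectivization K V) (W : Submodule K V) :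
    p.submodule ≤ W ↔ p.rep ∈ W := by
  rw [Projectivization.submodule_eq, Submodule.span_singleton_le_iff_mem]

theorem exists_point_not_le {U W : Submodule K V} (h : ¬ W ≤ U) :
    ∃ p : Projectivization K V, p.submodule ≤ W ∧ ¬ p.submodule ≤ U := by
  obtain ⟨v, hvW, hvU⟩ := SetLike.not_le_iff_exists.1 h
  obtain ⟨p, -, hp⟩ := exists_point_of_mem (K := K) (v := v) (by rintro rfl; exact hvU U.zero_mem)
  exact ⟨p, (hp W).2 hvW, fun h' => hvU ((hp U).1 h')⟩

variable [FiniteDimensional K V]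

theorem finrank_sup_point {U : Submodule K V} {p : Projectivization K V}
    (h : ¬ p.submodule ≤ U) :
    Module.finrank K ↥(U ⊔ p.submodule) = Module.finrank K U + 1 := by
  have h1 := Submodule.finrank_sup_add_finrank_inf_eq U p.submodule
  have h2 : U ⊓ p.submodule = ⊥ := by
    by_contra hne
    obtain ⟨v, hv, hv0⟩ := (Submodule.ne_bot_iff _).1 hne
    obtain ⟨r, -, hr⟩ := exists_point_of_mem (K := K) hv0
    have := eq_of_submodule_le ((hr _).2 hv.2)
    exact h (this ▸ (hr _).2 hv.1)
  rw [h2, finrank_bot, p.finrank_submodule] at h1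
  exact h1

theorem finrank_join {p r : Projectivization K V} (h : p ≠ r) :
    Module.finrank K ↥(p.submodule ⊔ r.submodule) = 2 := by
  rw [finrank_sup_point fun h' => h (eq_of_submodule_le h').symm, p.finrank_submodule]

theorem join_eq {p r : Projectivization K V} (h : p ≠ r) {l : Submodule K V}
    (hl : Module.finrank K l = 2) (hp : p.submodule ≤ l) (hr : r.submodule ≤ l) :
    p.submodule ⊔ r.submodule = l :=
  Submodule.eq_of_le_of_finrank_eq (sup_le hp hr) (by rw [finrank_join h, hl])

theorem line_eq {p r : Projectivization K V} (h : p ≠ r) {l m : Submodule K V}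
    (hl : Module.finrank K l = 2) (hm : Module.finrank K m = 2)
    (hp : p.submodule ≤ l) (hr : r.submodule ≤ l)
    (hp' : p.submodule ≤ m) (hr' : r.submodule ≤ m) : l = m := by
  rw [← join_eq h hl hp hr, join_eq h hm hp' hr']

/-- Two subspaces of a subspace `W` whose dimensions add up to more than that of `W` have a
common point. -/
theorem exists_common_point {U U' W : Submodule K V} (hU : U ≤ W) (hU' : U' ≤ W)
    (h : Module.finrank K W < Module.finrank K U + Module.finrank K U') :
    ∃ p : Projectivization K V, p.submodule ≤ U ∧ p.submodule ≤ U' := by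
  have h1 := Submodule.finrank_sup_add_finrank_inf_eq U U'
  have h2 := Submodule.finrank_mono (sup_le hU hU')
  have h3 : ¬ U ⊓ U' ≤ ⊥ := by
    intro h'
    rw [le_bot_iff.1 h', finrank_bot] at h1
    omega
  obtain ⟨p, hp, -⟩ := exists_point_not_le h3
  exact ⟨p, hp.trans inf_le_left, hp.trans inf_le_right⟩

theorem exists_line_through {p : Projectivization K V} {U : Submodule K V}
    (hp : p.submodule ≤ U) (hU : 2 ≤ Module.finrank K U) :
    ∃ l : Submodule K V, Module.finrank K l = 2 ∧ p.submodule ≤ l ∧ l ≤ U := by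
  have h : ¬ U ≤ p.submodule := fun h => by
    have := Submodule.finrank_mono h
    rw [p.finrank_submodule] at this
    omega
  obtain ⟨r, hr, hr'⟩ := exists_point_not_le h
  exact ⟨_, by rw [finrank_sup_point hr', p.finrank_submodule], le_sup_left, sup_le hp hr⟩

theorem two_le_finrank_inf (hV : Module.finrank K V = 4) {W W' : Submodule K V}
    (hW : Module.finrank K W = 3) (hW' : Module.finrank K W' = 3) :
    2 ≤ Module.finrank K ↥(W ⊓ W') := by
  have h1 := Submodule.finrank_sup_add_finrank_inf_eq W W'
  have h2 := Submodule.finrank_le (W ⊔ W')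
  omega

theorem finrank_sup_lines {p : Projectivization K V} {l m : Submodule K V}
    (hl : Module.finrank K l = 2) (hm : Module.finrank K m = 2) (h : l ≠ m)
    (hpl : p.submodule ≤ l) (hpm : p.submodule ≤ m) :
    Module.finrank K ↥(l ⊔ m) = 3 := by
  have h1 := Submodule.finrank_sup_add_finrank_inf_eq l m
  have h2 : 1 ≤ Module.finrank K ↥(l ⊓ m) := by
    rw [← p.finrank_submodule]; exact Submodule.finrank_mono (le_inf hpl hpm)
  have h3 : Module.finrank K ↥(l ⊓ m) < 2 := by
    by_contra h3
    have e1 := Submodule.eq_of_le_of_finrank_le (inf_le_left : l ⊓ m ≤ l) (by omega)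
    have e2 := Submodule.eq_of_le_of_finrank_le (inf_le_right : l ⊓ m ≤ m) (by omega)
    exact h (e1.symm.trans e2)
  omega

end Incidence

section Count

variable {K V : Type*} [Field K] [AddCommGroup V] [Module K V]

/-- The number of points of the set `A` that lie in the subspace `W`. -/
noncomputable def count (A : Set (Projectivization K V)) (W : Submodule K V) : ℕ :=
  (A ∩ {p | p.submodule ≤ W}).ncard

theorem count_top (A : Set (Projectivization K V)) : count A ⊤ = A.ncard := by
  simp [count]

theorem count_point_of_mem {A : Set (Projectivization K V)} {p : Projectivization K V}
    (hp : p ∈ A) : count A p.submodule = 1 := by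
  rw [count, Set.ncard_eq_one]
  refine ⟨p, Set.ext fun r => ⟨fun hr => eq_of_submodule_le hr.2, ?_⟩⟩
  rintro rfl
  exact ⟨hp, le_refl r.submodule⟩

variable [Finite V]

/-- The subspaces of `W` that contain `U` as a hyperplane. -/
noncomputable def pencil (U W : Submodule K V) : Finset (Submodule K V) :=
  (Set.toFinite {U' | U ≤ U' ∧ U' ≤ W ∧ Module.finrank K U' = Module.finrank K U + 1}).toFinset

theorem mem_pencil {U W U' : Submodule K V} :
    U' ∈ pencil U W ↔ U ≤ U' ∧ U' ≤ W ∧ Module.finrank K U' = Module.finrank K U + 1 := by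
  simp [pencil]

theorem mem_pencil_point {p : Projectivization K V} {l W : Submodule K V} :
    l ∈ pencil p.submodule W ↔ p.submodule ≤ l ∧ l ≤ W ∧ Module.finrank K l = 2 := by
  rw [mem_pencil, p.finrank_submodule]

theorem count_mono (A : Set (Projectivization K V)) {U W : Submodule K V} (h : U ≤ W) :
    count A U ≤ count A W :=
  Set.ncard_le_ncard (fun _ hp => ⟨hp.1, hp.2.trans h⟩) (Set.toFinite _)

theorem count_point_of_notMem {A : Set (Projectivization K V)} {p : Projectivization K V}
    (hp : p ∉ A) : count A p.submodule = 0 := by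
  rw [count, Set.ncard_eq_zero]
  refine Set.eq_empty_of_forall_notMem fun r hr => hp ?_
  rw [← eq_of_submodule_le hr.2]
  exact hr.1

theorem count_pos {A : Set (Projectivization K V)} {W : Submodule K V} :
    0 < count A W ↔ ∃ p ∈ A, p.submodule ≤ W := by
  rw [count, Set.ncard_pos]
  rfl

/-- The points of `A` in `W` outside `U` are distributed among the members of `pencil U W`. -/
theorem count_fan (A : Set (Projectivization K V)) {U W : Submodule K V} (h : U ≤ W) :
    (count A W : ℤ) = count A U + ∑ U' ∈ pencil U W, ((count A U' : ℤ) - count A U) := by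
  classical
  have hdiff : ∀ U' : Submodule K V, U ≤ U' →
      ((count A U' : ℤ) - count A U) =
        ((Set.toFinite (A ∩ {p | p.submodule ≤ U' ∧ ¬ p.submodule ≤ U})).toFinset.card : ℤ) := by
    intro U' hU'
    rw [← Set.ncard_eq_toFinset_card, count, count]
    have hsub : (A ∩ {p | p.submodule ≤ U}) ⊆ (A ∩ {p | p.submodule ≤ U'}) :=
      fun p hp => ⟨hp.1, hp.2.trans hU'⟩
    have hd := Set.ncard_sdiff_add_ncard_of_subset hsub (Set.toFinite _)
    have he : (A ∩ {p | p.submodule ≤ U'}) \ (A ∩ {p | p.submodule ≤ U}) =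
        A ∩ {p | p.submodule ≤ U' ∧ ¬ p.submodule ≤ U} := by
      ext p
      simp only [Set.mem_sdiff, Set.mem_inter_iff, Set.mem_ofPred_eq]
      tauto
    rw [he] at hd
    omega
  rw [← sub_eq_iff_eq_add', hdiff W h,
    Finset.sum_congr rfl fun U' hU' => hdiff U' (mem_pencil.1 hU').1, ← Nat.cast_sum]
  congr 1
  rw [Finset.card_eq_sum_card_fiberwise (f := fun p => U ⊔ p.submodule) (t := pencil U W)]
  · refine Finset.sum_congr rfl fun U' hU' => congrArg _ (Finset.ext fun p => ?_)
    obtain ⟨h1, h2, h3⟩ := mem_pencil.1 hU'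
    simp only [Finset.mem_filter, Set.Finite.mem_toFinset, Set.mem_inter_iff, Set.mem_ofPred_eq]
    constructor
    · rintro ⟨⟨hA, -, hpU⟩, rfl⟩
      exact ⟨hA, le_sup_right, hpU⟩
    · rintro ⟨hA, hpU', hpU⟩
      exact ⟨⟨hA, hpU'.trans h2, hpU⟩, Submodule.eq_of_le_of_finrank_eq (sup_le h1 hpU')
        (by rw [finrank_sup_point hpU, h3])⟩
  · intro p hp
    simp only [Set.Finite.coe_toFinset, Set.mem_inter_iff, Set.mem_ofPred_eq] at hp
    exact mem_pencil.2 ⟨le_sup_left, sup_le h hp.2.1, finrank_sup_point hp.2.2⟩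

theorem count_univ (W : Submodule K V) :
    count Set.univ W = ∑ i ∈ Finset.range (Module.finrank K W), Nat.card K ^ i := by
  -- for `V = 0` the field may be infinite, and then `Nat.card K = 0`
  have : Finite K ∨ Subsingleton V := by
    rcases subsingleton_or_nontrivial V with h | h
    · exact Or.inr h
    · obtain ⟨v, hv⟩ := exists_ne (0 : V)
      exact Or.inl (Finite.of_injective (fun k : K => k • v) (smul_left_injective K hv))
  rcases this with hK | hV
  · rw [← Projectivization.card_of_finrank K W rfl, count, Set.univ_inter, ← Nat.card_coe_set_eq]
    refine (Nat.card_congr (Equiv.ofBijective (fun p : Projectivization K W =>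
      (⟨Projectivization.map W.subtype W.injective_subtype p, ?_⟩ :
        ({p | p.submodule ≤ W} : Set (Projectivization K V)))) ⟨?_, ?_⟩)).symm
    · induction p using Projectivization.ind with
      | h v hv => simp [Projectivization.map_mk, Projectivization.submodule_mk]
    · intro p r h
      exact Projectivization.map_injective _ W.injective_subtype (Subtype.ext_iff.1 h)
    · rintro ⟨p, hp⟩
      have hp' := (point_le_iff p W).1 hp
      refine ⟨Projectivization.mk K ⟨p.rep, hp'⟩ fun h => p.rep_nonzero (Subtype.ext_iff.1 h),
        Subtype.ext ?_⟩
      simp [Projectivization.map_mk, Projectivization.mk_rep]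
  · have : IsEmpty (Projectivization K V) := ⟨fun p => p.rep_nonzero (Subsingleton.elim _ _)⟩
    rw [Module.finrank_zero_of_subsingleton, Finset.sum_range_zero, count,
      Set.eq_empty_of_isEmpty (_ ∩ _), Set.ncard_empty]

theorem count_univ_line {l : Submodule K V} (hl : Module.finrank K l = 2) :
    count Set.univ l = Nat.card K + 1 := by
  rw [count_univ, hl, Finset.sum_range_succ, Finset.sum_range_one]
  ring

theorem count_univ_plane {W : Submodule K V} (hW : Module.finrank K W = 3) :
    count Set.univ W = Nat.card K ^ 2 + Nat.card K + 1 := by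
  rw [count_univ, hW]
  simp only [Finset.sum_range_succ, Finset.sum_range_zero]
  ring

theorem card_pencil_mul {U W : Submodule K V} (h : U ≤ W) :
    (pencil U W).card * Nat.card K ^ Module.finrank K U + count Set.univ U =
      count Set.univ W := by
  have h1 := count_fan Set.univ h
  have h2 : ∀ U' ∈ pencil U W, ((count Set.univ U' : ℤ) - count Set.univ U) =
      (Nat.card K : ℤ) ^ Module.finrank K U := by
    intro U' hU'
    rw [count_univ U', (mem_pencil.1 hU').2.2, Finset.sum_range_succ, ← count_univ U]
    push_cast
    ring
  rw [Finset.sum_congr rfl h2, Finset.sum_const, nsmul_eq_mul] at h1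
  zify
  linarith

variable [Finite K]

theorem card_pencil_point_plane {p : Projectivization K V} {W : Submodule K V}
    (hW : Module.finrank K W = 3) (h : p.submodule ≤ W) :
    (pencil p.submodule W).card = Nat.card K + 1 := by
  have h1 := card_pencil_mul h
  rw [p.finrank_submodule, pow_one, count_univ_plane hW,
    count_point_of_mem (Set.mem_univ p)] at h1
  have : 0 < Nat.card K := Nat.card_pos
  nlinarith

theorem card_pencil_point (hV : Module.finrank K V = 4) (p : Projectivization K V) :
    (pencil p.submodule ⊤).card = Nat.card K ^ 2 + Nat.card K + 1 := by
  have h1 := card_pencil_mul (le_top : p.submodule ≤ ⊤)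
  rw [p.finrank_submodule, pow_one, count_point_of_mem (Set.mem_univ p), count_univ ⊤,
    finrank_top, hV] at h1
  simp only [Finset.sum_range_succ, Finset.sum_range_zero] at h1
  have : 0 < Nat.card K := Nat.card_pos
  refine Nat.eq_of_mul_eq_mul_right this ?_
  linarith

theorem card_pencil_line (hV : Module.finrank K V = 4) {l : Submodule K V}
    (hl : Module.finrank K l = 2) : (pencil l ⊤).card = Nat.card K + 1 := by
  have h1 := card_pencil_mul (le_top : l ≤ ⊤)
  rw [hl, count_univ_line hl, count_univ ⊤, finrank_top, hV] at h1
  simp only [Finset.sum_range_succ, Finset.sum_range_zero] at h1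
  have : 0 < Nat.card K := Nat.card_pos
  refine Nat.eq_of_mul_eq_mul_right (pow_pos this 2) ?_
  linarith

end Count

/-! ### Caps in even characteristic -/

section Cap

variable {K V : Type*} [Field K] [AddCommGroup V] [Module K V]

/-- A cap: a set of points that meets every line in at most two points. -/
def IsCap (A : Set (Projectivization K V)) : Prop :=
  ∀ l : Submodule K V, Module.finrank K l = 2 → count A l ≤ 2

theorem eq_of_count_eq_one {A : Set (Projectivization K V)} {l : Submodule K V}
    (h : count A l = 1) {p r : Projectivization K V} (hp : p ∈ A) (hpl : p.submodule ≤ l)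
    (hr : r ∈ A) (hrl : r.submodule ≤ l) : p = r := by
  obtain ⟨x, hx⟩ := Set.ncard_eq_one.1 h
  have h1 : p ∈ A ∩ {p | p.submodule ≤ l} := ⟨hp, hpl⟩
  have h2 : r ∈ A ∩ {p | p.submodule ≤ l} := ⟨hr, hrl⟩
  rw [hx] at h1 h2
  exact h1.trans h2.symm

variable [Finite V]

theorem count_eq_sum_of_notMem {A : Set (Projectivization K V)} {p : Projectivization K V}
    {W : Submodule K V} (hp : p ∉ A) (hpW : p.submodule ≤ W) :
    count A W = ∑ l ∈ pencil p.submodule W, count A l := by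
  have h := count_fan A hpW
  rw [count_point_of_notMem hp] at h
  simp only [Nat.cast_zero, sub_zero, zero_add] at h
  exact_mod_cast h

theorem isCap_insert {A : Set (Projectivization K V)} (hA : IsCap A) {p : Projectivization K V}
    (h : ∀ l : Submodule K V, Module.finrank K l = 2 → p.submodule ≤ l → count A l ≠ 2) :
    IsCap (insert p A) := by
  intro l hl
  by_cases hpl : p.submodule ≤ l
  · have h1 : count (insert p A) l ≤ count A l + 1 := by
      refine le_trans (Set.ncard_le_ncard ?_ (Set.toFinite _)) (Set.ncard_insert_le p _)
      rintro r ⟨hr | hr, hrl⟩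
      · exact Or.inl hr
      · exact Or.inr ⟨hr, hrl⟩
    have h2 := hA l hl
    have h3 := h l hl hpl
    omega
  · refine le_trans (Set.ncard_le_ncard ?_ (Set.toFinite _)) (hA l hl)
    rintro r ⟨hr | hr, hrl⟩
    · exact absurd (hr ▸ hrl) hpl
    · exact ⟨hr, hrl⟩

/-- Each line on a point of a cap that is not a tangent carries exactly one further point. -/
theorem IsCap.count_add_card_tangents {A : Set (Projectivization K V)} (hA : IsCap A)
    {p : Projectivization K V} (hp : p ∈ A) {W : Submodule K V} (hpW : p.submodule ≤ W) :
    count A W + ((pencil p.submodule W).filter fun l => count A l = 1).card =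
      (pencil p.submodule W).card + 1 := by
  have h := count_fan A hpW
  rw [count_point_of_mem hp] at h
  have h1 : ∀ l ∈ pencil p.submodule W,
      ((count A l : ℤ) - (1 : ℕ)) = 1 - if count A l = 1 then 1 else 0 := by
    intro l hl
    obtain ⟨h1, h2, h3⟩ := mem_pencil_point.1 hl
    have h4 := hA l h3
    have h5 := count_mono A h1
    rw [count_point_of_mem hp] at h5
    split_ifs <;> push_cast <;> omega
  rw [Finset.sum_congr rfl h1, Finset.sum_sub_distrib, Finset.sum_const, Finset.sum_boole] at h
  simp only [nsmul_eq_mul, mul_one, Nat.cast_one] at h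
  omega

/-- A subspace meeting a cap in an odd number of points contains a tangent through each of its
points off the cap. -/
theorem IsCap.exists_tangent_of_odd {A : Set (Projectivization K V)} (hA : IsCap A)
    {p : Projectivization K V} (hp : p ∉ A) {W : Submodule K V} (hpW : p.submodule ≤ W)
    (hodd : Odd (count A W)) :
    ∃ l : Submodule K V, Module.finrank K l = 2 ∧ p.submodule ≤ l ∧ l ≤ W ∧ count A l = 1 := by
  rw [count_eq_sum_of_notMem hp hpW] at hodd
  by_contra hcon
  refine Nat.not_even_iff_odd.2 hodd (Finset.even_sum _ fun l hl => ?_)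
  obtain ⟨h1, h2, h3⟩ := mem_pencil_point.1 hl
  have h4 := hA l h3
  have h5 : count A l ≠ 1 := fun h5 => hcon ⟨l, h3, h1, h2, h5⟩
  have h6 : count A l = 0 ∨ count A l = 2 := by omega
  rcases h6 with h6 | h6 <;> rw [h6] <;> decide

/-- `N` is the nucleus of the section of `A` by the plane `W`: the section has `q + 1` points and
all lines of `W` through `N` are tangents. -/
structure IsNucleus (A : Set (Projectivization K V)) (N : Projectivization K V)
    (W : Submodule K V) : Prop where
  finrank_eq : Module.finrank K W = 3
  count_eq : count A W = Nat.card K + 1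
  le : N.submodule ≤ W
  tangent : ∀ l : Submodule K V, Module.finrank K l = 2 → N.submodule ≤ l → l ≤ W →
    count A l = 1

/-- A plane on a nucleus meets the plane of the nucleus in a tangent. -/
theorem IsNucleus.exists_tangent {A : Set (Projectivization K V)} {W : Submodule K V}
    {N : Projectivization K V} (h : IsNucleus A N W) (hV : Module.finrank K V = 4)
    {W' : Submodule K V} (hW' : Module.finrank K W' = 3) (hN : N.submodule ≤ W') :
    ∃ l : Submodule K V, Module.finrank K l = 2 ∧ N.submodule ≤ l ∧ l ≤ W ∧ l ≤ W' ∧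
      count A l = 1 := by
  obtain ⟨l, hl, hNl, hlW⟩ := exists_line_through (le_inf h.le hN)
    (two_le_finrank_inf hV h.finrank_eq hW')
  exact ⟨l, hl, hNl, hlW.trans inf_le_left, hlW.trans inf_le_right,
    h.tangent l hl hNl (hlW.trans inf_le_left)⟩

variable [Finite K]

theorem IsCap.count_plane_add {A : Set (Projectivization K V)} (hA : IsCap A)
    {p : Projectivization K V} (hp : p ∈ A) {W : Submodule K V} (hpW : p.submodule ≤ W)
    (hW : Module.finrank K W = 3) :
    count A W + ((pencil p.submodule W).filter fun l => count A l = 1).card =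
      Nat.card K + 2 := by
  rw [hA.count_add_card_tangents hp hpW, card_pencil_point_plane hW hpW]

theorem IsCap.count_plane_le {A : Set (Projectivization K V)} (hA : IsCap A)
    {W l : Submodule K V} (hW : Module.finrank K W = 3) (hl : Module.finrank K l = 2)
    (hlW : l ≤ W) (ht : count A l = 1) : count A W ≤ Nat.card K + 1 := by
  obtain ⟨p, hp, hpl⟩ := count_pos.1 (ht ▸ one_pos : 0 < count A l)
  have h := hA.count_plane_add hp (hpl.trans hlW) hW
  have : 0 < ((pencil p.submodule W).filter fun l => count A l = 1).card :=
    Finset.card_pos.2 ⟨l, Finset.mem_filter.2 ⟨mem_pencil_point.2 ⟨hpl, hlW, hl⟩, ht⟩⟩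
  omega

section Oval

variable {A : Set (Projectivization K V)} {W : Submodule K V}

theorem IsCap.tangent_unique (hA : IsCap A) (hW : Module.finrank K W = 3)
    (hc : count A W = Nat.card K + 1) {p : Projectivization K V} (hp : p ∈ A)
    {l m : Submodule K V} (hl : Module.finrank K l = 2) (hm : Module.finrank K m = 2)
    (hpl : p.submodule ≤ l) (hpm : p.submodule ≤ m) (hlW : l ≤ W) (hmW : m ≤ W)
    (htl : count A l = 1) (htm : count A m = 1) : l = m := by
  have h := hA.count_plane_add hp (hpl.trans hlW) hW
  have h1 : ((pencil p.submodule W).filter fun l => count A l = 1).card ≤ 1 := by omega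
  exact Finset.card_le_one.1 h1 l
    (Finset.mem_filter.2 ⟨mem_pencil_point.2 ⟨hpl, hlW, hl⟩, htl⟩) m
    (Finset.mem_filter.2 ⟨mem_pencil_point.2 ⟨hpm, hmW, hm⟩, htm⟩)

theorem IsCap.exists_tangent (hA : IsCap A) (heven : Even (Nat.card K))
    (hW : Module.finrank K W = 3) (hc : count A W = Nat.card K + 1)
    {p : Projectivization K V} (hpW : p.submodule ≤ W) :
    ∃ l : Submodule K V, Module.finrank K l = 2 ∧ p.submodule ≤ l ∧ l ≤ W ∧ count A l = 1 := by
  by_cases hp : p ∈ A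
  · have h := hA.count_plane_add hp hpW hW
    obtain ⟨l, hl⟩ := Finset.card_pos.1
      (by omega : 0 < ((pencil p.submodule W).filter fun l => count A l = 1).card)
    obtain ⟨h1, h2⟩ := Finset.mem_filter.1 hl
    obtain ⟨h3, h4, h5⟩ := mem_pencil_point.1 h1
    exact ⟨l, h5, h3, h4, h2⟩
  · exact hA.exists_tangent_of_odd hp hpW (hc ▸ heven.add_one)

/-- In a plane with `q + 1` points of the cap, a point on a secant lies on only one tangent: the
`q + 1` points of the secant lie on tangents, which have different points of contact, so these
are all the tangents of the plane. -/
theorem IsCap.tangent_unique_of_secant (hA : IsCap A) (heven : Even (Nat.card K))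
    (hW : Module.finrank K W = 3) (hc : count A W = Nat.card K + 1)
    {s : Submodule K V} (hs : Module.finrank K s = 2) (hsW : s ≤ W) (hcs : count A s = 2)
    {N : Projectivization K V} (hN : N.submodule ≤ s)
    {l m : Submodule K V} (hl : Module.finrank K l = 2) (hm : Module.finrank K m = 2)
    (hNl : N.submodule ≤ l) (hNm : N.submodule ≤ m) (hlW : l ≤ W) (hmW : m ≤ W)
    (htl : count A l = 1) (htm : count A m = 1) : l = m := by
  have hex : ∀ Y : Projectivization K V, ∃ P : Projectivization K V, ∃ t : Submodule K V,
      Y.submodule ≤ s → P ∈ A ∧ P.submodule ≤ t ∧ Module.finrank K t = 2 ∧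
        Y.submodule ≤ t ∧ t ≤ W ∧ count A t = 1 := by
    intro Y
    by_cases hY : Y.submodule ≤ s
    · obtain ⟨t, h1, h2, h3, h4⟩ := hA.exists_tangent heven hW hc (hY.trans hsW)
      obtain ⟨P, hP, hPt⟩ := count_pos.1 (h4 ▸ one_pos : 0 < count A t)
      exact ⟨P, t, fun _ => ⟨hP, hPt, h1, h2, h3, h4⟩⟩
    · exact ⟨Y, ⊥, fun h => absurd h hY⟩
  choose P t hPt using hex
  have hinj : Set.InjOn P {Y | Y.submodule ≤ s} := by
    intro Y hY Z hZ hYZ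
    obtain ⟨a1, a2, a3, a4, a5, a6⟩ := hPt Y hY
    obtain ⟨b1, b2, b3, b4, b5, b6⟩ := hPt Z hZ
    have htt : t Y = t Z :=
      hA.tangent_unique hW hc a1 a3 b3 a2 (by rw [hYZ]; exact b2) a5 b5 a6 b6
    by_contra hne
    have := line_eq hne hs a3 hY hZ a4 (by rw [htt]; exact b4)
    rw [this, a6] at hcs
    omega
  have himg : P '' {Y | Y.submodule ≤ s} = A ∩ {p | p.submodule ≤ W} := by
    refine Set.eq_of_subset_of_ncard_le ?_ ?_ (Set.toFinite _)
    · rintro _ ⟨Y, hY, rfl⟩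
      obtain ⟨a1, a2, a3, a4, a5, a6⟩ := hPt Y hY
      exact ⟨a1, a2.trans a5⟩
    · rw [hinj.ncard_image]
      have h1 := count_univ_line (K := K) hs
      rw [count, Set.univ_inter] at h1
      rw [h1, ← hc, count]
  -- every tangent of the plane through `N` is the chosen one
  have key : ∀ l : Submodule K V, Module.finrank K l = 2 → N.submodule ≤ l → l ≤ W →
      count A l = 1 → l = t N := by
    intro l hl hNl hlW htl
    obtain ⟨Q, hQ, hQl⟩ := count_pos.1 (htl ▸ one_pos : 0 < count A l)
    have hQ' : Q ∈ A ∩ {p | p.submodule ≤ W} := ⟨hQ, hQl.trans hlW⟩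
    rw [← himg] at hQ'
    obtain ⟨Y, hY, rfl⟩ := hQ'
    obtain ⟨a1, a2, a3, a4, a5, a6⟩ := hPt Y hY
    have hlt : l = t Y := hA.tangent_unique hW hc a1 hl a3 hQl a2 hlW a5 htl a6
    by_cases hNY : N = Y
    · rw [hlt, hNY]
    · have := line_eq hNY hs hl hN hY hNl (hlt ▸ a4)
      rw [this, htl] at hcs
      omega
  rw [key l hl hNl hlW htl, key m hm hNm hmW htm]

end Oval

variable {A : Set (Projectivization K V)} {W : Submodule K V} {N : Projectivization K V}

/-- A point of the cap lies on only one tangent of a plane with `q + 1` points. -/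
theorem IsNucleus.notMem (h : IsNucleus A N W) (hA : IsCap A) : N ∉ A := by
  intro hN
  have h1 := hA.count_plane_add hN h.le h.finrank_eq
  rw [Finset.filter_true_of_mem, card_pencil_point_plane h.finrank_eq h.le, h.count_eq] at h1
  · have : 0 < Nat.card K := Nat.card_pos
    omega
  · intro l hl
    obtain ⟨h1, h2, h3⟩ := mem_pencil_point.1 hl
    exact h.tangent l h3 h1 h2

theorem IsCap.exists_nucleus (hA : IsCap A) (heven : Even (Nat.card K))
    (hW : Module.finrank K W = 3) (hc : count A W = Nat.card K + 1)
    {t : Submodule K V} (ht : Module.finrank K t = 2) (htW : t ≤ W) (hct : count A t = 1) :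
    ∃ N : Projectivization K V, N.submodule ≤ t ∧ IsNucleus A N W := by
  obtain ⟨Q, ⟨hQA, hQW⟩, hQt⟩ : ∃ Q, Q ∈ A ∩ {p | p.submodule ≤ W} ∧ ¬ Q.submodule ≤ t := by
    by_contra! hcon
    have h1 : count A W ≤ count A t :=
      Set.ncard_le_ncard (fun Q hQ => ⟨hQ.1, hcon Q hQ⟩) (Set.toFinite _)
    have : 0 < Nat.card K := Nat.card_pos
    omega
  obtain ⟨u, hu, hQu, huW, hcu⟩ := hA.exists_tangent heven hW hc hQW
  obtain ⟨N, hNt, hNu⟩ := exists_common_point htW huW (by omega)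
  have hNA : N ∉ A := by
    intro hN
    have := eq_of_count_eq_one hcu hQA hQu hN hNu
    exact hQt (this ▸ hNt)
  have hle : ∀ l ∈ pencil N.submodule W, count A l ≤ 1 := by
    intro l hl
    obtain ⟨h1, h2, h3⟩ := mem_pencil_point.1 hl
    by_contra h4
    have h5 : count A l = 2 := le_antisymm (hA l h3) (by omega)
    have := hA.tangent_unique_of_secant heven hW hc h3 h2 h5 h1 ht hu hNt hNu htW huW hct hcu
    exact hQt (this ▸ hQu)
  have hNW := hNt.trans htW
  have hsum := count_eq_sum_of_notMem hNA hNW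
  have hall := (Finset.sum_eq_sum_iff_of_le hle).1 (by
    rw [← hsum, hc, Finset.sum_const, card_pencil_point_plane hW hNW]; simp)
  exact ⟨N, hNt, hW, hc, hNW, fun l h1 h2 h3 => hall l (mem_pencil_point.2 ⟨h2, h3, h1⟩)⟩

/-- If a nucleus lies on a secant, no plane on that secant has more than `q + 1` points. -/
theorem IsNucleus.card_le_of_secant (h : IsNucleus A N W) (hA : IsCap A)
    (hV : Module.finrank K V = 4) {s : Submodule K V} (hs : Module.finrank K s = 2)
    (hNs : N.submodule ≤ s) (hcs : count A s = 2) :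
    A.ncard ≤ Nat.card K ^ 2 + 1 ∧ (A.ncard = Nat.card K ^ 2 + 1 →
      ∀ W' : Submodule K V, Module.finrank K W' = 3 → s ≤ W' → count A W' = Nat.card K + 1) := by
  have h1 := count_fan A (le_top : s ≤ ⊤)
  rw [count_top, hcs] at h1
  have h2 : ∀ W' ∈ pencil s ⊤, ((count A W' : ℤ) - (2 : ℕ)) ≤ Nat.card K - 1 := by
    intro W' hW'
    obtain ⟨a1, -, a3⟩ := mem_pencil.1 hW'
    rw [hs] at a3
    obtain ⟨l, b1, b2, b3, b4, b5⟩ := h.exists_tangent hV a3 (hNs.trans a1)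
    have := hA.count_plane_le a3 b1 b4 b5
    push_cast
    omega
  have h3 := Finset.sum_le_sum h2
  have h4 : ∑ _W' ∈ pencil s ⊤, ((Nat.card K : ℤ) - 1) = (Nat.card K + 1) * (Nat.card K - 1) := by
    rw [Finset.sum_const, card_pencil_line hV hs, nsmul_eq_mul]
    push_cast
    ring
  constructor
  · zify
    push_cast at h1 h3 h4 ⊢
    linarith
  · intro hcard W' hW' hsW'
    have h5 := (Finset.sum_eq_sum_iff_of_le h2).1 (by
      rw [hcard] at h1
      push_cast at h1 h4 ⊢
      linarith) W' (mem_pencil.2 ⟨hsW', le_top, by rw [hs, hW']⟩)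
    push_cast at h5
    omega

/-- A large cap meets some plane on a given tangent in `q + 1` points. -/
theorem IsCap.exists_oval_plane (hA : IsCap A) (hV : Module.finrank K V = 4)
    (hcard : Nat.card K ^ 2 + 1 ≤ A.ncard) {t : Submodule K V} (ht : Module.finrank K t = 2)
    (hct : count A t = 1) :
    ∃ W : Submodule K V, Module.finrank K W = 3 ∧ t ≤ W ∧ count A W = Nat.card K + 1 := by
  by_contra! hcon
  have h1 := count_fan A (le_top : t ≤ ⊤)
  rw [count_top, hct] at h1
  have h2 : ∀ W' ∈ pencil t ⊤, ((count A W' : ℤ) - (1 : ℕ)) ≤ Nat.card K - 1 := by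
    intro W' hW'
    obtain ⟨a1, -, a3⟩ := mem_pencil.1 hW'
    rw [ht] at a3
    have b1 := hA.count_plane_le a3 ht a1 hct
    have b2 := hcon W' a3 a1
    push_cast
    omega
  have h3 := Finset.sum_le_sum h2
  rw [Finset.sum_const, card_pencil_line hV ht, nsmul_eq_mul] at h3
  zify at hcard
  push_cast at h1 h3
  nlinarith

theorem not_add_two_dvd {q : ℕ} (hq : 2 < q) : ¬ q + 2 ∣ q ^ 2 + q + 2 := by
  intro h
  have h1 : ((q + 2 : ℕ) : ℤ) ∣ ((q ^ 2 + q + 2 : ℕ) : ℤ) := Int.natCast_dvd_natCast.2 h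
  have h2 : ((q + 2 : ℕ) : ℤ) ∣ 4 := by
    have h3 := dvd_sub h1 (dvd_mul_right ((q + 2 : ℕ) : ℤ) ((q : ℤ) - 1))
    have h4 : ((q ^ 2 + q + 2 : ℕ) : ℤ) - ((q + 2 : ℕ) : ℤ) * ((q : ℤ) - 1) = 4 := by
      push_cast
      ring
    rwa [h4] at h3
  have h5 := Int.le_of_dvd (by norm_num) h2
  omega

/-- A cap without tangents would be met by every plane in `0` or `q + 2` points, and then
`q + 2` would divide its size `q ^ 2 + q + 2`. -/
theorem IsCap.exists_tangent_line (hA : IsCap A) (hV : Module.finrank K V = 4)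
    (hq : 2 < Nat.card K) (hne : A.Nonempty) :
    ∃ t : Submodule K V, Module.finrank K t = 2 ∧ count A t = 1 := by
  by_contra! hcon
  have hplane : ∀ W : Submodule K V, Module.finrank K W = 3 →
      count A W = 0 ∨ count A W = Nat.card K + 2 := by
    intro W hW
    rcases Nat.eq_zero_or_pos (count A W) with h | h
    · exact Or.inl h
    · obtain ⟨p, hp, hpW⟩ := count_pos.1 h
      have h1 := hA.count_plane_add hp hpW hW
      rw [Finset.filter_false_of_mem] at h1
      · exact Or.inr (by simpa using h1)
      · intro l hl
        exact hcon l (mem_pencil_point.1 hl).2.2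
  obtain ⟨p, hp⟩ := hne
  have hcard : A.ncard = Nat.card K ^ 2 + Nat.card K + 2 := by
    have h1 := hA.count_add_card_tangents hp (le_top : p.submodule ≤ ⊤)
    rw [Finset.filter_false_of_mem, card_pencil_point hV, count_top] at h1
    · simpa using h1
    · intro l hl
      exact hcon l (mem_pencil_point.1 hl).2.2
  obtain ⟨l₀, hl₀⟩ : (pencil p.submodule ⊤).Nonempty := by
    rw [← Finset.card_pos, card_pencil_point hV]; omega
  obtain ⟨W, hW⟩ : (pencil l₀ ⊤).Nonempty := by
    rw [← Finset.card_pos, card_pencil_line hV (mem_pencil_point.1 hl₀).2.2]; omega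
  have hW3 : Module.finrank K W = 3 := by
    rw [(mem_pencil.1 hW).2.2, (mem_pencil_point.1 hl₀).2.2]
  have hpW : p.submodule ≤ W := (mem_pencil_point.1 hl₀).1.trans (mem_pencil.1 hW).1
  have hcW : count A W = Nat.card K + 2 :=
    (hplane W hW3).resolve_left (count_pos.2 ⟨p, hp, hpW⟩).ne'
  -- a point of `W` off the cap, and a line of `W` through it that misses the cap
  obtain ⟨X, hXW, hXA⟩ : ∃ X : Projectivization K V, X.submodule ≤ W ∧ X ∉ A := by
    by_contra! h
    have h1 : count Set.univ W ≤ count A W :=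
      Set.ncard_le_ncard (fun X hX => ⟨h X hX.2, hX.2⟩) (Set.toFinite _)
    rw [count_univ_plane hW3, hcW] at h1
    nlinarith
  obtain ⟨e, he, heW, hce⟩ : ∃ e : Submodule K V, Module.finrank K e = 2 ∧ e ≤ W ∧
      count A e = 0 := by
    by_contra! h
    have h1 : ∀ l ∈ pencil X.submodule W, 2 ≤ count A l := by
      intro l hl
      obtain ⟨-, a2, a3⟩ := mem_pencil_point.1 hl
      have := h l a3 a2
      have := hcon l a3
      omega
    have h2 := Finset.card_nsmul_le_sum _ _ _ h1
    rw [← count_eq_sum_of_notMem hXA hXW, hcW, card_pencil_point_plane hW3 hXW,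
      smul_eq_mul] at h2
    omega
  refine not_add_two_dvd hq ?_
  have h1 := count_fan A (le_top : e ≤ ⊤)
  rw [count_top, hcard, hce] at h1
  simp only [Nat.cast_zero, sub_zero, zero_add] at h1
  rw [Nat.cast_inj.1 (h1.trans (Nat.cast_sum _ _).symm)]
  refine Finset.dvd_sum fun W' hW' => ?_
  rcases hplane W' (by rw [(mem_pencil.1 hW').2.2, he]) with h | h
  · rw [h]; exact dvd_zero _
  · rw [h]

/-- A cap has at most `q ^ 2 + 1` points for even `q > 2`. In a larger cap of maximal size, a
nucleus could be added to the cap, so there is no tangent. -/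
theorem IsCap.ncard_le (hA : IsCap A) (hV : Module.finrank K V = 4)
    (heven : Even (Nat.card K)) (hq : 2 < Nat.card K) : A.ncard ≤ Nat.card K ^ 2 + 1 := by
  obtain ⟨B, hB, hmax⟩ := Set.exists_max_image {B : Set (Projectivization K V) | IsCap B}
    Set.ncard (Set.toFinite _) ⟨A, hA⟩
  refine (hmax A hA).trans ?_
  by_contra! hlt
  have hne : B.Nonempty := (Set.ncard_pos (Set.toFinite _)).1 (by omega)
  obtain ⟨t, ht, hct⟩ := IsCap.exists_tangent_line hB hV hq hne
  obtain ⟨W, hW, htW, hcW⟩ := IsCap.exists_oval_plane hB hV hlt.le ht hct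
  obtain ⟨N, -, hN⟩ := IsCap.exists_nucleus hB heven hW hcW ht htW hct
  have h1 : IsCap (insert N B) := isCap_insert hB fun s hs hNs hcs =>
    absurd (hN.card_le_of_secant hB hV hs hNs hcs).1 (not_le.2 hlt)
  have h2 := hmax _ h1
  rw [Set.ncard_insert_of_notMem (hN.notMem hB) (Set.toFinite _)] at h2
  omega

end Cap

/-! ### The tangents of an ovoid form a null system -/

section Ovoid

variable {K V : Type*} [Field K] [AddCommGroup V] [Module K V] [Finite K] [Finite V]
  {A : Set (Projectivization K V)} {W : Submodule K V} {N : Projectivization K V}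

theorem IsNucleus.exists_secant (h : IsNucleus A N W) (hA : IsCap A)
    (hV : Module.finrank K V = 4) (heven : Even (Nat.card K)) (hq : 2 < Nat.card K)
    (hcard : A.ncard = Nat.card K ^ 2 + 1) :
    ∃ s : Submodule K V, Module.finrank K s = 2 ∧ N.submodule ≤ s ∧ count A s = 2 := by
  by_contra! hcon
  have h1 := IsCap.ncard_le (isCap_insert hA hcon) hV heven hq
  rw [Set.ncard_insert_of_notMem (h.notMem hA) (Set.toFinite _)] at h1
  omega

/-- A tangent through a nucleus `N` outside the plane of `N` would span, with a secant through
`N`, a plane with `q + 1` points in which `N` is on a secant and on two tangents. -/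
theorem IsNucleus.le_of_tangent (h : IsNucleus A N W) (hA : IsCap A)
    (hV : Module.finrank K V = 4) (heven : Even (Nat.card K)) (hq : 2 < Nat.card K)
    (hcard : A.ncard = Nat.card K ^ 2 + 1) {t : Submodule K V} (ht : Module.finrank K t = 2)
    (hNt : N.submodule ≤ t) (hct : count A t = 1) : t ≤ W := by
  obtain ⟨s, hs, hNs, hcs⟩ := h.exists_secant hA hV heven hq hcard
  have hst : s ≠ t := by
    rintro rfl
    omega
  have hW' := finrank_sup_lines hs ht hst hNs hNt
  obtain ⟨u, hu, hNu, huW, huW', hcu⟩ := h.exists_tangent hV hW' (hNs.trans le_sup_left)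
  have hc := (h.card_le_of_secant hA hV hs hNs hcs).2 hcard _ hW' le_sup_left
  rw [hA.tangent_unique_of_secant heven hW' hc hs le_sup_left hcs hNs ht hu hNt hNu le_sup_right
    huW' hct hcu]
  exact huW

theorem IsNucleus.count_plane (h : IsNucleus A N W) (hA : IsCap A)
    (hV : Module.finrank K V = 4) (heven : Even (Nat.card K)) (hq : 2 < Nat.card K)
    (hcard : A.ncard = Nat.card K ^ 2 + 1) {W' : Submodule K V}
    (hW' : Module.finrank K W' = 3) (hN : N.submodule ≤ W') :
    count A W' = 1 ∨ count A W' = Nat.card K + 1 := by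
  by_cases hsec : ∃ s : Submodule K V, Module.finrank K s = 2 ∧ N.submodule ≤ s ∧ s ≤ W' ∧
      count A s = 2
  · obtain ⟨s, hs, hNs, hsW', hcs⟩ := hsec
    exact Or.inr ((h.card_le_of_secant hA hV hs hNs hcs).2 hcard W' hW' hsW')
  · by_cases hWW : W = W'
    · exact Or.inr (hWW ▸ h.count_eq)
    left
    obtain ⟨u, hu, hNu, huW, huW', hcu⟩ := h.exists_tangent hV hW' hN
    rw [count_eq_sum_of_notMem (h.notMem hA) hN, Finset.sum_eq_single u, hcu]
    · intro l hl hlu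
      obtain ⟨h1, h2, h3⟩ := mem_pencil_point.1 hl
      by_contra hcl
      have h4 := hA l h3
      have h5 : count A l ≠ 2 := fun h5 => hsec ⟨l, h3, h1, h2, h5⟩
      have hlW := h.le_of_tangent hA hV heven hq hcard h3 h1 (by omega)
      have h6 := finrank_sup_lines h3 hu hlu h1 hNu
      have e1 := Submodule.eq_of_le_of_finrank_eq (sup_le hlW huW) (by rw [h6, h.finrank_eq])
      have e2 := Submodule.eq_of_le_of_finrank_eq (sup_le h2 huW') (by rw [h6, hW'])
      exact hWW (e1.symm.trans e2)
    · intro hu'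
      exact absurd (mem_pencil_point.2 ⟨hNu, huW', hu⟩) hu'

/-- Of the `q + 1` planes on a tangent to an ovoid, `q` meet the ovoid in `q + 1` points and one
meets it in one point. -/
theorem IsCap.planes_on_tangent (hA : IsCap A)
    (hV : Module.finrank K V = 4) (heven : Even (Nat.card K)) (hq : 2 < Nat.card K)
    (hcard : A.ncard = Nat.card K ^ 2 + 1) {t : Submodule K V}
    (ht : Module.finrank K t = 2) (hct : count A t = 1) :
    ((pencil t ⊤).filter fun W => count A W = Nat.card K + 1).card = Nat.card K ∧
      ∃ W ∈ pencil t ⊤, count A W = 1 := by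
  obtain ⟨W, hW, htW, hcW⟩ := hA.exists_oval_plane hV hcard.ge ht hct
  obtain ⟨N, hNt, hN⟩ := hA.exists_nucleus heven hW hcW ht htW hct
  have h1 := count_fan A (le_top : t ≤ ⊤)
  rw [count_top, hcard, hct] at h1
  have hall : ∀ W' ∈ pencil t ⊤, count A W' = 1 ∨ count A W' = Nat.card K + 1 := by
    intro W' hW'
    obtain ⟨a1, -, a3⟩ := mem_pencil.1 hW'
    exact hN.count_plane hA hV heven hq hcard (by rw [a3, ht]) (hNt.trans a1)
  have h2 : ∀ W' ∈ pencil t ⊤, ((count A W' : ℤ) - (1 : ℕ)) =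
      Nat.card K * if count A W' = Nat.card K + 1 then 1 else 0 := by
    intro W' hW'
    have h3 := hall W' hW'
    split_ifs with h4
    · rw [h4]; push_cast; ring
    · rw [h3.resolve_right h4]; simp
  rw [Finset.sum_congr rfl h2, ← Finset.mul_sum, Finset.sum_boole] at h1
  have h5 : ((pencil t ⊤).filter fun W => count A W = Nat.card K + 1).card = Nat.card K := by
    have h6 : Nat.card K * ((pencil t ⊤).filter fun W => count A W = Nat.card K + 1).card =
        Nat.card K * Nat.card K := by
      refine Nat.cast_injective (R := ℤ) ?_
      push_cast at h1 ⊢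
      linarith
    exact Nat.eq_of_mul_eq_mul_left (by omega) h6
  refine ⟨h5, ?_⟩
  by_contra! hcon
  rw [Finset.filter_true_of_mem fun W' hW' => (hall W' hW').resolve_left (hcon W' hW'),
    card_pencil_line hV ht] at h5
  omega

/-- The tangents at a point of an ovoid are the lines through that point in a plane. -/
theorem IsCap.exists_tangent_plane_of_mem (hA : IsCap A)
    (hV : Module.finrank K V = 4) (heven : Even (Nat.card K)) (hq : 2 < Nat.card K)
    (hcard : A.ncard = Nat.card K ^ 2 + 1) {X : Projectivization K V} (hX : X ∈ A) :
    ∃ H : Submodule K V, Module.finrank K H = 3 ∧ X.submodule ≤ H ∧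
      ∀ l : Submodule K V, Module.finrank K l = 2 → X.submodule ≤ l →
        (count A l = 1 ↔ l ≤ H) := by
  have h1 : ((pencil X.submodule ⊤).filter fun l => count A l = 1).card = Nat.card K + 1 := by
    have h2 := hA.count_add_card_tangents hX (le_top : X.submodule ≤ ⊤)
    rw [count_top, hcard, card_pencil_point hV] at h2
    omega
  obtain ⟨t, ht⟩ := Finset.card_pos.1 (by rw [h1]; exact Nat.succ_pos _)
  obtain ⟨ht1, hct⟩ := Finset.mem_filter.1 ht
  obtain ⟨hXt, -, ht2⟩ := mem_pencil_point.1 ht1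
  obtain ⟨-, H, hH, hcH⟩ := hA.planes_on_tangent hV heven hq hcard ht2 hct
  obtain ⟨htH, -, hH3⟩ := mem_pencil.1 hH
  rw [ht2] at hH3
  have hXH := hXt.trans htH
  have hsub : pencil X.submodule H ⊆ (pencil X.submodule ⊤).filter fun l => count A l = 1 := by
    intro l hl
    obtain ⟨a1, a2, a3⟩ := mem_pencil_point.1 hl
    have a4 := count_mono A a2
    have a5 := count_mono A a1
    rw [count_point_of_mem hX] at a5
    exact Finset.mem_filter.2 ⟨mem_pencil_point.2 ⟨a1, le_top, a3⟩, by omega⟩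
  have heq := Finset.eq_of_subset_of_card_le hsub
    (by rw [h1, card_pencil_point_plane hH3 hXH])
  refine ⟨H, hH3, hXH, fun l hl hXl => ⟨fun hcl => ?_, fun hlH => ?_⟩⟩
  · have : l ∈ pencil X.submodule H := by
      rw [heq]
      exact Finset.mem_filter.2 ⟨mem_pencil_point.2 ⟨hXl, le_top, hl⟩, hcl⟩
    exact (mem_pencil_point.1 this).2.1
  · exact (Finset.mem_filter.1 (hsub (mem_pencil_point.2 ⟨hXl, hlH, hl⟩))).2

/-- A point off an ovoid is a nucleus: it lies on a tangent, and the `q` planes on this tangent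
with `q + 1` points have different nuclei, which are all the points of the tangent off the
ovoid. -/
theorem IsCap.exists_isNucleus_of_notMem (hA : IsCap A)
    (hV : Module.finrank K V = 4) (heven : Even (Nat.card K)) (hq : 2 < Nat.card K)
    (hcard : A.ncard = Nat.card K ^ 2 + 1) {X : Projectivization K V} (hX : X ∉ A) :
    ∃ W : Submodule K V, IsNucleus A X W := by
  obtain ⟨t, ht, hXt, -, hct⟩ := hA.exists_tangent_of_odd hX (le_top : X.submodule ≤ ⊤) (by
    rw [count_top, hcard]
    exact (heven.pow_of_ne_zero two_ne_zero).add_one)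
  have hex : ∀ W : Submodule K V, ∃ N : Projectivization K V,
      W ∈ (pencil t ⊤).filter (fun W => count A W = Nat.card K + 1) →
        N.submodule ≤ t ∧ IsNucleus A N W := by
    intro W
    by_cases hW : W ∈ (pencil t ⊤).filter fun W => count A W = Nat.card K + 1
    · obtain ⟨h1, h2⟩ := Finset.mem_filter.1 hW
      obtain ⟨h3, -, h4⟩ := mem_pencil.1 h1
      obtain ⟨N, hN⟩ := hA.exists_nucleus heven (by rw [h4, ht]) h2 ht h3 hct
      exact ⟨N, fun _ => hN⟩
    · exact ⟨X, fun h => absurd h hW⟩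
  choose N hN using hex
  have hinj : Set.InjOn N ((pencil t ⊤).filter fun W => count A W = Nat.card K + 1) := by
    intro W hW W' hW' hNN
    obtain ⟨-, h1⟩ := hN W hW
    obtain ⟨-, h2⟩ := hN W' hW'
    rw [← hNN] at h2
    refine Submodule.eq_of_le_of_finrank_eq ?_ (h1.finrank_eq.trans h2.finrank_eq.symm)
    by_contra hle
    obtain ⟨r, hr, hr'⟩ := exists_point_not_le hle
    have hne : N W ≠ r := by
      rintro rfl
      exact hr' h2.le
    exact hr' (le_sup_right.trans (h2.le_of_tangent hA hV heven hq hcard (finrank_join hne)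
      le_sup_left (h1.tangent _ (finrank_join hne) le_sup_left (sup_le h1.le hr))))
  have himg : N '' ((pencil t ⊤).filter fun W => count A W = Nat.card K + 1) =
      {p | p.submodule ≤ t} \ (A ∩ {p | p.submodule ≤ t}) := by
    refine Set.eq_of_subset_of_ncard_le ?_ ?_ (Set.toFinite _)
    · rintro _ ⟨W, hW, rfl⟩
      obtain ⟨h1, h2⟩ := hN W hW
      exact ⟨h1, fun h => h2.notMem hA h.1⟩
    · rw [hinj.ncard_image, Set.ncard_coe_finset,
        (hA.planes_on_tangent hV heven hq hcard ht hct).1]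
      have h1 := Set.ncard_sdiff_add_ncard_of_subset
        (Set.inter_subset_right : A ∩ {p | p.submodule ≤ t} ⊆ {p | p.submodule ≤ t})
        (Set.toFinite _)
      have h2 := count_univ_line (K := K) ht
      rw [count, Set.univ_inter] at h2
      rw [← count, hct, h2] at h1
      omega
  have hXm : X ∈ ({p | p.submodule ≤ t} \ (A ∩ {p | p.submodule ≤ t}) :
      Set (Projectivization K V)) := ⟨hXt, fun h => hX h.1⟩
  rw [← himg] at hXm
  obtain ⟨W, hW, rfl⟩ := hXm
  exact ⟨W, (hN W hW).2⟩

theorem IsCap.exists_tangent_plane (hA : IsCap A)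
    (hV : Module.finrank K V = 4) (heven : Even (Nat.card K)) (hq : 2 < Nat.card K)
    (hcard : A.ncard = Nat.card K ^ 2 + 1) (X : Projectivization K V) :
    ∃ H : Submodule K V, Module.finrank K H = 3 ∧ X.submodule ≤ H ∧
      ∀ l : Submodule K V, Module.finrank K l = 2 → X.submodule ≤ l →
        (count A l = 1 ↔ l ≤ H) := by
  by_cases hX : X ∈ A
  · exact hA.exists_tangent_plane_of_mem hV heven hq hcard hX
  · obtain ⟨W, hW⟩ := hA.exists_isNucleus_of_notMem hV heven hq hcard hX
    exact ⟨W, hW.finrank_eq, hW.le, fun l hl hXl =>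
      ⟨hW.le_of_tangent hA hV heven hq hcard hl hXl, hW.tangent l hl hXl⟩⟩

end Ovoid

/-! ### Null systems and symplectic polarities -/

section NullSystem

variable {K V : Type*} [Field K] [AddCommGroup V] [Module K V]

/-- A null system: a symmetric assignment of a plane `H p` through `p` to each point `p`. -/
structure IsNullSystem (H : Projectivization K V → Submodule K V) : Prop where
  finrank_eq : ∀ p, Module.finrank K (H p) = 3
  self_le : ∀ p : Projectivization K V, p.submodule ≤ H p
  symm : ∀ p r : Projectivization K V, p.submodule ≤ H r → r.submodule ≤ H p

/-- The subspace of all vectors orthogonal to `W` with respect to `H`. -/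
def perp (H : Projectivization K V → Submodule K V) (W : Submodule K V) : Submodule K V :=
  ⨅ p : {p : Projectivization K V // p.submodule ≤ W}, H p

theorem le_perp_iff {H : Projectivization K V → Submodule K V} {U W : Submodule K V} :
    U ≤ perp H W ↔ ∀ p : Projectivization K V, p.submodule ≤ W → U ≤ H p := by
  simp [perp, le_iInf_iff]

theorem perp_antitone (H : Projectivization K V → Submodule K V) : Antitone (perp H) :=
  fun _ _ h => le_perp_iff.2 fun p hp => le_perp_iff.1 le_rfl p (hp.trans h)

theorem le_of_forall_point {U W : Submodule K V}
    (h : ∀ p : Projectivization K V, p.submodule ≤ U → p.submodule ≤ W) : U ≤ W := by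
  by_contra hcon
  obtain ⟨p, hp, hp'⟩ := exists_point_not_le hcon
  exact hp' (h p hp)

theorem perp_point (H : Projectivization K V → Submodule K V) (p : Projectivization K V) :
    perp H p.submodule = H p := by
  refine le_antisymm (le_perp_iff.1 le_rfl p le_rfl) (le_perp_iff.2 fun r hr => ?_)
  rw [eq_of_submodule_le hr]

variable {H : Projectivization K V → Submodule K V}

theorem IsNullSystem.le_iff_le_perp (hH : IsNullSystem H) {p : Projectivization K V}
    {W : Submodule K V} : W ≤ H p ↔ p.submodule ≤ perp H W := by
  constructor
  · intro h
    exact le_perp_iff.2 fun r hr => hH.symm _ _ (hr.trans h)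
  · intro h
    exact le_of_forall_point fun r hr => hH.symm _ _ (le_perp_iff.1 h r hr)

theorem IsNullSystem.le_perp_perp (hH : IsNullSystem H) (W : Submodule K V) :
    W ≤ perp H (perp H W) :=
  le_perp_iff.2 fun _ hp => hH.le_iff_le_perp.2 hp

theorem IsNullSystem.perp_sup_point (hH : IsNullSystem H) (W : Submodule K V)
    (r : Projectivization K V) : perp H (W ⊔ r.submodule) = perp H W ⊓ H r := by
  refine le_antisymm (le_inf (perp_antitone H le_sup_left)
    (le_perp_iff.1 le_rfl r le_sup_right)) (le_of_forall_point fun s hs => ?_)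
  exact hH.le_iff_le_perp.1 (sup_le (hH.le_iff_le_perp.2 (hs.trans inf_le_left))
    (hH.symm _ _ (hs.trans inf_le_right)))

theorem IsSymplecticPolarity.le_comm {π : Submodule K V → Submodule K V}
    (hπ : IsSymplecticPolarity π) {U W : Submodule K V} (h : U ≤ π W) : W ≤ π U := by
  rw [← hπ.involutive W]
  exact hπ.antitone h

theorem IsSymplecticPolarity.map_bot {π : Submodule K V → Submodule K V}
    (hπ : IsSymplecticPolarity π) : π ⊥ = ⊤ :=
  top_le_iff.1 (hπ.le_comm bot_le)

variable [FiniteDimensional K V]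

theorem IsNullSystem.perp_top (hH : IsNullSystem H) (hV : Module.finrank K V = 4) :
    perp H ⊤ = ⊥ := by
  refine le_bot_iff.1 (le_of_forall_point fun p hp => ?_)
  have h1 := Submodule.finrank_mono (hH.le_iff_le_perp.2 hp)
  rw [finrank_top, hV, hH.finrank_eq] at h1
  omega

theorem IsNullSystem.finrank_perp_le_succ (hH : IsNullSystem H) (hV : Module.finrank K V = 4)
    (W : Submodule K V) (r : Projectivization K V) :
    Module.finrank K (perp H W) ≤ Module.finrank K (perp H (W ⊔ r.submodule)) + 1 := by
  have h1 := Submodule.finrank_sup_add_finrank_inf_eq (perp H W) (H r)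
  have h2 := Submodule.finrank_le (perp H W ⊔ H r)
  rw [hH.finrank_eq] at h1
  rw [hH.perp_sup_point]
  omega

/-- Along a maximal flag from `⊥` to `⊤` the dimension of `perp H` drops by at most one in each
step, and it drops from `4` to `0`. -/
theorem IsNullSystem.finrank_perp (hH : IsNullSystem H) (hV : Module.finrank K V = 4)
    (W : Submodule K V) : Module.finrank K (perp H W) + Module.finrank K W = 4 := by
  have hle : ∀ n : ℕ, ∀ W : Submodule K V, Module.finrank K W + n = 4 →
      Module.finrank K (perp H W) ≤ n := by
    intro n
    induction n with
    | zero =>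
      intro W hW
      rw [Submodule.eq_top_of_finrank_eq (by omega : Module.finrank K W = Module.finrank K V),
        hH.perp_top hV, finrank_bot]
    | succ n ih =>
      intro W hW
      obtain ⟨r, -, hr⟩ := exists_point_not_le (U := W) (W := ⊤) (by
        intro h
        have := Submodule.finrank_mono h
        rw [finrank_top] at this
        omega)
      have h1 := ih (W ⊔ r.submodule) (by rw [finrank_sup_point hr]; omega)
      have h2 := hH.finrank_perp_le_succ hV W r
      omega
  have hge : ∀ n : ℕ, ∀ W : Submodule K V, Module.finrank K W = n →
      4 ≤ Module.finrank K (perp H W) + n := by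
    intro n
    induction n with
    | zero =>
      intro W hW
      have : perp H W = ⊤ := by
        refine top_le_iff.1 (le_perp_iff.2 fun p hp => ?_)
        have := Submodule.finrank_mono hp
        rw [p.finrank_submodule] at this
        omega
      rw [this, finrank_top, hV]
    | succ n ih =>
      intro W hW
      obtain ⟨r, hr, -⟩ := exists_point_not_le (U := ⊥) (W := W) (by
        intro h
        have := Submodule.finrank_mono h
        rw [finrank_bot] at this
        omega)
      -- a hyperplane `U` of `W` that does not contain `r`
      obtain ⟨C, hC⟩ := exists_isCompl r.submodule
      have hU : (C ⊓ W) ⊔ r.submodule = W := by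
        rw [sup_comm, ← sup_inf_assoc_of_le C hr, hC.sup_eq_top, top_inf_eq]
      have hr' : ¬ r.submodule ≤ C ⊓ W := by
        intro h
        have h1 := hC.disjoint le_rfl (h.trans inf_le_left)
        have h2 := Submodule.finrank_mono h1
        rw [finrank_bot, r.finrank_submodule] at h2
        omega
      have h1 := finrank_sup_point hr'
      rw [hU, hW] at h1
      have h2 := ih (C ⊓ W) (by omega)
      have h3 := hH.finrank_perp_le_succ hV (C ⊓ W) r
      rw [hU] at h3
      omega
  have h1 := hge _ W rfl
  have h2 := Submodule.finrank_le W
  have h3 := hle (4 - Module.finrank K W) W (by omega)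
  omega

theorem IsNullSystem.perp_perp (hH : IsNullSystem H) (hV : Module.finrank K V = 4)
    (W : Submodule K V) : perp H (perp H W) = W := by
  refine (Submodule.eq_of_le_of_finrank_eq (hH.le_perp_perp W) ?_).symm
  have h1 := hH.finrank_perp hV W
  have h2 := hH.finrank_perp hV (perp H W)
  omega

theorem IsNullSystem.isSymplecticPolarity (hH : IsNullSystem H) (hV : Module.finrank K V = 4) :
    IsSymplecticPolarity (perp H) where
  antitone := perp_antitone H
  involutive := hH.perp_perp hV
  absolute p := by rw [perp_point]; exact hH.self_le p

/-- The planes polar to the points under a symplectic polarity form a null system. -/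
theorem IsSymplecticPolarity.isNullSystem {π : Submodule K V → Submodule K V}
    (hπ : IsSymplecticPolarity π) (hV : Module.finrank K V = 4) :
    IsNullSystem fun p : Projectivization K V => π p.submodule where
  finrank_eq p := by
    have hne : π p.submodule ≠ ⊤ := by
      intro h
      have h1 : p.submodule = ⊥ := by
        rw [← hπ.involutive p.submodule, h, ← hπ.map_bot, hπ.involutive]
      have h2 := p.finrank_submodule
      rw [h1, finrank_bot] at h2
      omega
    have hlt := Submodule.finrank_lt hne
    by_contra h3
    -- a subspace strictly between `π p` and `⊤`
    obtain ⟨r, -, hr⟩ := exists_point_not_le (U := π p.submodule) (W := ⊤)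
      (fun h => hne (top_le_iff.1 h))
    have h4 := finrank_sup_point hr
    have h5 : π (π p.submodule ⊔ r.submodule) ≤ ⊥ := by
      refine le_of_forall_point fun s hs => ?_
      have h6 : s.submodule ≤ p.submodule := by
        rw [← hπ.involutive p.submodule]
        exact hs.trans (hπ.antitone le_sup_left)
      rw [eq_of_submodule_le h6] at hs
      exact absurd (le_sup_right.trans (hπ.le_comm hs)) hr
    have h7 : π p.submodule ⊔ r.submodule = ⊤ := by
      rw [← hπ.involutive (π p.submodule ⊔ r.submodule), le_bot_iff.1 h5, hπ.map_bot]
    rw [h7, finrank_top] at h4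
    omega
  self_le := hπ.absolute
  symm _ _ h := hπ.le_comm h

/-- The absolute lines of a symplectic polarity are determined by its values on points. -/
theorem IsSymplecticPolarity.le_map_iff {π : Submodule K V → Submodule K V}
    (hπ : IsSymplecticPolarity π) {l : Submodule K V} {p : Projectivization K V}
    (hl : Module.finrank K l = 2) (hp : p.submodule ≤ l) :
    l ≤ π l ↔ l ≤ π p.submodule := by
  refine ⟨fun h => h.trans (hπ.antitone hp), fun h => ?_⟩
  obtain ⟨r, hr, hrp⟩ := exists_point_not_le (U := p.submodule) (W := l) (by
    intro hle
    have := Submodule.finrank_mono hle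
    rw [p.finrank_submodule] at this
    omega)
  have hpr : p ≠ r := by
    rintro rfl
    exact hrp le_rfl
  have hlr : l ≤ π r.submodule := by
    rw [← join_eq hpr hl hp hr]
    exact sup_le (hπ.le_comm (hr.trans h)) (hπ.absolute r)
  calc l = p.submodule ⊔ r.submodule := (join_eq hpr hl hp hr).symm
    _ ≤ π l := sup_le (hπ.le_comm h) (hπ.le_comm hlr)

end NullSystem

/-! ### Tangent planes of an ovoidal fibration -/

section Cover

variable {K V : Type*} [Field K] [AddCommGroup V] [Module K V] [Finite V]

theorem card_points_plane_diff {H H' : Submodule K V} (hV : Module.finrank K V = 4)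
    (hH : Module.finrank K H = 3) (hH' : Module.finrank K H' = 3) :
    {p : Projectivization K V | p.submodule ≤ H' ∧ ¬ p.submodule ≤ H}.ncard ≤
      Nat.card K ^ 2 := by
  have h1 : {p : Projectivization K V | p.submodule ≤ H' ∧ ¬ p.submodule ≤ H} =
      {p | p.submodule ≤ H'} \ {p | p.submodule ≤ H' ⊓ H} := by
    ext p
    simp only [Set.mem_ofPred_eq, Set.mem_sdiff, le_inf_iff]
    tauto
  have hsub : {p : Projectivization K V | p.submodule ≤ H' ⊓ H} ⊆ {p | p.submodule ≤ H'} := by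
    intro p hp
    exact le_trans (show p.submodule ≤ H' ⊓ H from hp) inf_le_left
  have h2 := Set.ncard_sdiff_add_ncard_of_subset hsub (Set.toFinite _)
  have h3 : ∀ W : Submodule K V, {p : Projectivization K V | p.submodule ≤ W}.ncard =
      count Set.univ W := fun W => by rw [count, Set.univ_inter]
  have h4 : Nat.card K + 1 ≤ count Set.univ (H' ⊓ H) := by
    have h5 := two_le_finrank_inf hV hH' hH
    rw [count_univ]
    refine le_trans ?_ (Finset.sum_le_sum_of_subset (Finset.range_mono h5))
    simp [Finset.sum_range_succ, add_comm]
  rw [h3, h3, count_univ_plane hH'] at h2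
  rw [h1]
  omega

/-- If `q + 1` planes cover the space, a point outside one of them lies on only one of them:
there are `q ^ 3` points outside a plane, and each of the `q` other planes covers at most `q ^ 2`
of these. -/
theorem cover_unique {ι : Type*} [Finite ι] (hι : Nat.card ι = Nat.card K + 1)
    (hV : Module.finrank K V = 4) {H : ι → Submodule K V}
    (hH : ∀ i, Module.finrank K (H i) = 3)
    (hcov : ∀ p : Projectivization K V, ∃ i, p.submodule ≤ H i)
    {p : Projectivization K V} {i j k : ι} (hi : ¬ p.submodule ≤ H i)
    (hj : p.submodule ≤ H j) (hk : p.submodule ≤ H k) : j = k := by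
  classical
  have := Fintype.ofFinite ι
  rw [Nat.card_eq_fintype_card] at hι
  set S : Finset (Projectivization K V) :=
    (Set.toFinite {p : Projectivization K V | ¬ p.submodule ≤ H i}).toFinset with hS
  have hmem : ∀ p, p ∈ S ↔ ¬ p.submodule ≤ H i := fun p => by simp [hS]
  have hcard : S.card = Nat.card K ^ 3 := by
    have h1 : {p : Projectivization K V | ¬ p.submodule ≤ H i} =
        Set.univ \ {p | p.submodule ≤ H i} := by
      ext p
      simp
    have h2 := Set.ncard_sdiff_add_ncard_of_subset
      (Set.subset_univ {p : Projectivization K V | p.submodule ≤ H i}) (Set.toFinite _)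
    have h3 : {p : Projectivization K V | p.submodule ≤ H i}.ncard = count Set.univ (H i) := by
      rw [count, Set.univ_inter]
    rw [← h1, h3, count_univ_plane (hH i), ← count_top Set.univ, count_univ, finrank_top,
      hV] at h2
    simp only [Finset.sum_range_succ, Finset.sum_range_zero, pow_zero, pow_one] at h2
    rw [hS, ← Set.ncard_eq_toFinset_card]
    omega
  have hdouble : ∑ p ∈ S, (Finset.univ.filter fun k => p.submodule ≤ H k).card =
      ∑ k, (S.filter fun p => p.submodule ≤ H k).card :=
    Finset.sum_card_bipartiteAbove_eq_sum_card_bipartiteBelow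
      (fun (p : Projectivization K V) k => p.submodule ≤ H k)
  have hbound : ∑ k, (S.filter fun p => p.submodule ≤ H k).card ≤ S.card := by
    rw [← Finset.add_sum_erase _ _ (Finset.mem_univ i), Finset.filter_false_of_mem
      fun p hp => (hmem p).1 hp, Finset.card_empty, zero_add]
    refine (Finset.sum_le_card_nsmul _ _ (Nat.card K ^ 2) fun k _ => ?_).trans ?_
    · refine le_trans (le_of_eq ?_) (card_points_plane_diff hV (hH i) (hH k))
      rw [← Set.ncard_coe_finset]
      congr 1
      ext p
      simp [hmem, and_comm]
    · rw [Finset.card_erase_of_mem (Finset.mem_univ i), Finset.card_univ, hι, hcard, smul_eq_mul,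
        Nat.add_sub_cancel]
      exact le_of_eq (by ring)
  have hone : ∀ p ∈ S, 1 ≤ (Finset.univ.filter fun k => p.submodule ≤ H k).card := by
    intro p _
    obtain ⟨k, hk⟩ := hcov p
    exact Finset.card_pos.2 ⟨k, by simpa using hk⟩
  have hall := (Finset.sum_eq_sum_iff_of_le hone).1 (by
    refine le_antisymm (Finset.sum_le_sum hone) ?_
    rw [hdouble, Finset.sum_const, smul_eq_mul, mul_one]
    exact hbound)
  exact Finset.card_le_one.1 (hall p ((hmem p).2 hi)).ge j (by simpa using hj) k
    (by simpa using hk)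

end Cover

section Fibration

variable {K V : Type*} [Field K] [AddCommGroup V] [Module K V]

theorem isTangent_iff {ℓ : Line K V} {θ : Set (Projectivization K V)} :
    IsTangent ℓ θ ↔ count θ ℓ.1 = 1 := by
  rw [IsTangent, Set.inter_comm]
  rfl

theorem isSecant_iff {ℓ : Line K V} {θ : Set (Projectivization K V)} :
    IsSecant ℓ θ ↔ count θ ℓ.1 = 2 := by
  rw [IsSecant, Set.inter_comm]
  rfl

theorem disjoint_iff_count [Finite V] {ℓ : Line K V} {θ : Set (Projectivization K V)} :
    Disjoint ℓ.points θ ↔ count θ ℓ.1 = 0 := by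
  rw [disjoint_comm, Set.disjoint_iff_inter_eq_empty, count, Set.ncard_eq_zero]
  rfl

theorem IsOvoid.isCap [Finite V] {θ : Set (Projectivization K V)} (h : IsOvoid θ) :
    IsCap θ := by
  intro l hl
  by_contra! hlt
  obtain ⟨x, y, z, hx, hy, hz, hxy, hxz, hyz⟩ := (Set.two_lt_ncard_iff (Set.toFinite _)).1 hlt
  exact h.2 x hx.1 y hy.1 z hz.1 hxy hxz hyz ⟨⟨l, hl⟩, hx.2, hy.2, hz.2⟩

theorem IsOvoid.exists_isNullSystem [Finite K] [Finite V] {θ : Set (Projectivization K V)}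
    (h : IsOvoid θ) (hV : Module.finrank K V = 4) (heven : Even (Nat.card K))
    (hq : 2 < Nat.card K) :
    ∃ H : Projectivization K V → Submodule K V, IsNullSystem H ∧
      ∀ (p : Projectivization K V) (ℓ : Line K V), p.submodule ≤ ℓ.1 →
        (IsTangent ℓ θ ↔ ℓ.1 ≤ H p) := by
  choose H h3 hself htan using h.isCap.exists_tangent_plane hV heven hq h.1
  refine ⟨H, ⟨h3, hself, fun p r hpr => ?_⟩, fun p ℓ hp => ?_⟩
  · by_cases hne : p = r
    · rw [hne]; exact hself r
    · have h1 := finrank_join hne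
      exact le_sup_right.trans ((htan p _ h1 le_sup_left).1
        ((htan r _ h1 le_sup_right).2 (sup_le hpr (hself r))))
  · rw [isTangent_iff]
    exact htan p ℓ.1 ℓ.2 hp

/-- The points of a line are distributed among the ovoids of a fibration. -/
theorem IsOvoidalFibration.sum_count [Finite K] [Finite V]
    {θ : Fin (Nat.card K + 1) → Set (Projectivization K V)} (hθ : IsOvoidalFibration θ)
    (ℓ : Line K V) : ∑ i, count (θ i) ℓ.1 = Nat.card K + 1 := by
  classical
  have hex : ∀ p : Projectivization K V, ∃ i, p ∈ θ i := fun p =>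
    Set.mem_iUnion.1 (hθ.cover ▸ Set.mem_univ p)
  choose f hf using hex
  have huniq : ∀ p i, p ∈ θ i → f p = i := by
    intro p i hp
    by_contra hne
    exact Set.disjoint_left.1 (hθ.disjoint _ _ hne) (hf p) hp
  refine Eq.trans ?_ (count_univ_line ℓ.2)
  rw [count, Set.univ_inter, Set.ncard_eq_toFinset_card _ (Set.toFinite _),
    Finset.card_eq_sum_card_fiberwise (f := f) (t := Finset.univ) (by simp)]
  refine Finset.sum_congr rfl fun i _ => ?_
  rw [count, ← Set.ncard_coe_finset]
  congr 1
  ext p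
  simp only [Set.mem_inter_iff, Set.mem_ofPred_eq, Finset.coe_filter, Set.Finite.mem_toFinset]
  exact ⟨fun h => ⟨h.2, huniq p i h.1⟩, fun h => ⟨h.2 ▸ hf p, h.1⟩⟩

theorem IsOvoidalFibration.exists_isTangent [Finite K] [Finite V]
    {θ : Fin (Nat.card K + 1) → Set (Projectivization K V)} (hθ : IsOvoidalFibration θ)
    (heven : Even (Nat.card K)) (ℓ : Line K V) : ∃ i, IsTangent ℓ (θ i) := by
  by_contra! hcon
  have h1 : Even (∑ i, count (θ i) ℓ.1) := by
    refine Finset.even_sum _ fun i _ => ?_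
    have h2 := (hθ.isOvoid i).isCap ℓ.1 ℓ.2
    have h3 : count (θ i) ℓ.1 ≠ 1 := fun h => hcon i (isTangent_iff.2 h)
    have h6 : count (θ i) ℓ.1 = 0 ∨ count (θ i) ℓ.1 = 2 := by omega
    rcases h6 with h6 | h6 <;> rw [h6] <;> decide
  rw [hθ.sum_count] at h1
  exact Nat.not_even_iff_odd.2 heven.add_one h1

/-- A family of null systems `H i` whose lines are the tangents of the sets `θ i`, such that each
line is a tangent of at least one of these sets. -/
structure IsTangentSystem {ι : Type*} (θ : ι → Set (Projectivization K V))
    (H : ι → Projectivization K V → Submodule K V) : Prop where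
  isNullSystem : ∀ i, IsNullSystem (H i)
  isTangent_iff_le : ∀ i (p : Projectivization K V) (ℓ : Line K V), p.submodule ≤ ℓ.1 →
    (IsTangent ℓ (θ i) ↔ ℓ.1 ≤ H i p)
  exists_isTangent : ∀ ℓ : Line K V, ∃ i, IsTangent ℓ (θ i)

theorem IsOvoidalFibration.exists_isTangentSystem [Finite K] [Finite V]
    {θ : Fin (Nat.card K + 1) → Set (Projectivization K V)} (hθ : IsOvoidalFibration θ)
    (hV : Module.finrank K V = 4) (heven : Even (Nat.card K)) (hq : 2 < Nat.card K) :
    ∃ H, IsTangentSystem θ H := by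
  choose H h1 h2 using fun i => (hθ.isOvoid i).exists_isNullSystem hV heven hq
  exact ⟨H, h1, h2, hθ.exists_isTangent heven⟩

theorem Line.exists_point (ℓ : Line K V) : ∃ p : Projectivization K V, p.submodule ≤ ℓ.1 := by
  have : ¬ ℓ.1 ≤ ⊥ := by
    intro h
    have h1 := ℓ.2
    rw [le_bot_iff.1 h, finrank_bot] at h1
    omega
  obtain ⟨p, hp, -⟩ := exists_point_not_le this
  exact ⟨p, hp⟩

section TangentSystem

variable [Finite V] {ι : Type*} {θ : ι → Set (Projectivization K V)}
  {H : ι → Projectivization K V → Submodule K V}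

theorem IsTangentSystem.exists_le (hι : Nat.card ι = Nat.card K + 1)
    (h : IsTangentSystem θ H) (p r : Projectivization K V) :
    ∃ i, r.submodule ≤ H i p := by
  by_cases hpr : p = r
  · have : Nonempty ι := (Nat.card_pos_iff.1 (by omega : 0 < Nat.card ι)).1
    obtain ⟨i⟩ := this
    exact ⟨i, hpr ▸ (h.isNullSystem i).self_le p⟩
  · obtain ⟨i, hi⟩ := h.exists_isTangent ⟨_, finrank_join hpr⟩
    exact ⟨i, le_sup_right.trans ((h.isTangent_iff_le i p _ le_sup_left).1 hi)⟩

variable [Finite ι] (hι : Nat.card ι = Nat.card K + 1) (hV : Module.finrank K V = 4)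

include hι hV

theorem IsTangentSystem.le_unique (h : IsTangentSystem θ H) {p r : Projectivization K V}
    {i j k : ι} (hi : ¬ r.submodule ≤ H i p) (hj : r.submodule ≤ H j p)
    (hk : r.submodule ≤ H k p) : j = k :=
  cover_unique hι hV (fun i => (h.isNullSystem i).finrank_eq p) (h.exists_le hι p) hi hj hk

theorem IsTangentSystem.inf_le (h : IsTangentSystem θ H) {i j : ι} (hij : i ≠ j) (k : ι)
    (p : Projectivization K V) : H i p ⊓ H j p ≤ H k p := by
  refine le_of_forall_point fun r hr => ?_
  by_contra hk
  exact hij (h.le_unique hι hV hk (hr.trans inf_le_left) (hr.trans inf_le_right))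

theorem IsTangentSystem.ne (h : IsTangentSystem θ H) {i j : ι} (hij : i ≠ j)
    (p : Projectivization K V) : H i p ≠ H j p := by
  intro heq
  have hle : ∀ k, H k p = H i p := by
    intro k
    have h1 := h.inf_le hι hV hij k p
    rw [← heq, inf_idem] at h1
    exact (Submodule.eq_of_le_of_finrank_eq h1
      (((h.isNullSystem i).finrank_eq p).trans ((h.isNullSystem k).finrank_eq p).symm)).symm
  obtain ⟨r, -, hr⟩ := exists_point_not_le (U := H i p) (W := ⊤) (by
    intro h1
    have h2 := Submodule.finrank_mono h1
    rw [(h.isNullSystem i).finrank_eq p, finrank_top] at h2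
    omega)
  obtain ⟨k, hk⟩ := h.exists_le hι p r
  exact hr (hle k ▸ hk)

theorem IsTangentSystem.mem_commonTangents (h : IsTangentSystem θ H) {i j : ι} (hij : i ≠ j)
    {ℓ : Line K V} (hi : IsTangent ℓ (θ i)) (hj : IsTangent ℓ (θ j)) :
    ℓ ∈ commonTangents θ := by
  intro k
  obtain ⟨p, hp⟩ := ℓ.exists_point
  rw [h.isTangent_iff_le _ p ℓ hp] at hi hj ⊢
  exact (le_inf hi hj).trans (h.inf_le hι hV hij k p)

variable [Finite K]

theorem IsTangentSystem.exists_mem_commonTangents (h : IsTangentSystem θ H)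
    (p : Projectivization K V) : ∃ ℓ ∈ commonTangents θ, p.submodule ≤ ℓ.1 := by
  have : Nontrivial ι := by
    rw [← Finite.one_lt_card_iff_nontrivial, hι]
    exact Nat.lt_add_of_pos_left Nat.card_pos
  obtain ⟨i, j, hij⟩ := exists_pair_ne ι
  obtain ⟨l, hl, hpl, hlij⟩ := exists_line_through
    (le_inf ((h.isNullSystem i).self_le p) ((h.isNullSystem j).self_le p))
    (two_le_finrank_inf hV ((h.isNullSystem i).finrank_eq p) ((h.isNullSystem j).finrank_eq p))
  exact ⟨⟨l, hl⟩, fun k => (h.isTangent_iff_le k p _ hpl).2 (hlij.trans (h.inf_le hι hV hij k p)),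
    hpl⟩

theorem IsTangentSystem.eq_of_mem_commonTangents (h : IsTangentSystem θ H)
    {p : Projectivization K V} {ℓ m : Line K V} (hℓ : ℓ ∈ commonTangents θ)
    (hm : m ∈ commonTangents θ) (hpℓ : p.submodule ≤ ℓ.1) (hpm : p.submodule ≤ m.1) :
    ℓ = m := by
  have : Nontrivial ι := by
    rw [← Finite.one_lt_card_iff_nontrivial, hι]
    exact Nat.lt_add_of_pos_left Nat.card_pos
  obtain ⟨i, j, hij⟩ := exists_pair_ne ι
  by_contra hne
  have h1 := finrank_sup_lines ℓ.2 m.2 (fun h => hne (Subtype.ext h)) hpℓ hpm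
  have h2 : ∀ k, ℓ.1 ⊔ m.1 = H k p := fun k => Submodule.eq_of_le_of_finrank_eq
    (sup_le ((h.isTangent_iff_le k p ℓ hpℓ).1 (hℓ k)) ((h.isTangent_iff_le k p m hpm).1 (hm k)))
    (by rw [h1, (h.isNullSystem k).finrank_eq])
  exact h.ne hι hV hij p ((h2 i).symm.trans (h2 j))

theorem IsTangentSystem.isSpread_commonTangents (h : IsTangentSystem θ H)
    (hcard : ∀ i, (θ i).ncard = Nat.card K ^ 2 + 1) : IsSpread (commonTangents θ) := by
  constructor
  · have : Nonempty ι := (Nat.card_pos_iff.1 (by omega : 0 < Nat.card ι)).1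
    obtain ⟨i⟩ := this
    -- each line of the spread touches `θ i` in one point
    choose f hf hf' using h.exists_mem_commonTangents hι hV
    have himg : f '' θ i = commonTangents θ := by
      ext ℓ
      constructor
      · rintro ⟨p, -, rfl⟩
        exact hf p
      · intro hℓ
        obtain ⟨p, hp, hpℓ⟩ := count_pos.1
          (isTangent_iff.1 (hℓ i) ▸ one_pos : 0 < count (θ i) ℓ.1)
        exact ⟨p, hp, h.eq_of_mem_commonTangents hι hV (hf p) hℓ (hf' p) hpℓ⟩
    rw [← himg, ← hcard i]
    refine Set.InjOn.ncard_image fun p hp r hr hpr => ?_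
    exact eq_of_count_eq_one (isTangent_iff.1 (hf p i)) hp (hf' p) hr (hpr ▸ hf' r)
  · intro ℓ hℓ m hm hne
    refine Set.disjoint_left.2 fun p hp hp' => hne ?_
    exact h.eq_of_mem_commonTangents hι hV hℓ hm hp hp'

end TangentSystem

end Fibration

/-! ### The general linear complexes on the spread -/

section Complex

variable {K V : Type*} [Field K] [AddCommGroup V] [Module K V] [Finite V] {ι : Type*}
  {θ : ι → Set (Projectivization K V)} {H : ι → Projectivization K V → Submodule K V}

theorem IsTangentSystem.isGeneralLinearComplex (h : IsTangentSystem θ H)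
    (hV : Module.finrank K V = 4) (i : ι) : IsGeneralLinearComplex (tangentLines (θ i)) := by
  refine ⟨perp (H i), (h.isNullSystem i).isSymplecticPolarity hV, Set.ext fun ℓ => ?_⟩
  obtain ⟨p, hp⟩ := ℓ.exists_point
  have h1 := ((h.isNullSystem i).isSymplecticPolarity hV).le_map_iff ℓ.2 hp
  rw [perp_point] at h1
  exact (h.isTangent_iff_le i p ℓ hp).trans h1.symm

theorem exists_point_off_lines (hq : 2 ≤ Nat.card K) {m a b : Submodule K V}
    (hm : Module.finrank K m = 2) (ha : Module.finrank K a = 2) (hb : Module.finrank K b = 2)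
    (hma : m ≠ a) (hmb : m ≠ b) :
    ∃ p : Projectivization K V, p.submodule ≤ m ∧ ¬ p.submodule ≤ a ∧ ¬ p.submodule ≤ b := by
  by_contra! hcon
  have hone : ∀ l : Submodule K V, Module.finrank K l = 2 → m ≠ l →
      {p : Projectivization K V | p.submodule ≤ m ∧ p.submodule ≤ l}.ncard ≤ 1 := by
    intro l hl hne
    refine (Set.ncard_le_one_iff (Set.toFinite _)).2 fun {p r} hp hr => ?_
    by_contra hpr
    exact hne (line_eq hpr hm hl hp.1 hr.1 hp.2 hr.2)
  have h1 := count_univ_line (K := K) hm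
  rw [count, Set.univ_inter] at h1
  have h2 : {p : Projectivization K V | p.submodule ≤ m} ⊆
      {p | p.submodule ≤ m ∧ p.submodule ≤ a} ∪ {p | p.submodule ≤ m ∧ p.submodule ≤ b} := by
    intro p hp
    by_cases hpa : p.submodule ≤ a
    · exact Or.inl ⟨hp, hpa⟩
    · exact Or.inr ⟨hp, hcon p hp hpa⟩
  have h3 := (Set.ncard_le_ncard h2 (Set.toFinite _)).trans (Set.ncard_union_le _ _)
  have h4 := hone a ha hma
  have h5 := hone b hb hmb
  omega

variable [Finite K] [Finite ι]

/-- The polar plane of a point `X` contains the spread line on `X`, so it is `H i X` for some `i`.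
This index is the same for the points of a line of the complex outside the spread, and any two
points on different spread lines are joined by two such lines. -/
theorem IsTangentSystem.eq_tangentLines (h : IsTangentSystem θ H)
    (hι : Nat.card ι = Nat.card K + 1) (hV : Module.finrank K V = 4) (hq : 2 ≤ Nat.card K)
    {M : Set (Line K V)} (hM : IsGeneralLinearComplex M) (hS : commonTangents θ ⊆ M) :
    ∃ i, tangentLines (θ i) = M := by
  obtain ⟨π, hπ, rfl⟩ := hM
  have hG := hπ.isNullSystem hV
  choose s hs hps using h.exists_mem_commonTangents hι hV
  have hsπ : ∀ X, (s X).1 ≤ π X.submodule := fun X =>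
    (hπ.le_map_iff (s X).2 (hps X)).1 (hS (hs X))
  have hex : ∀ X : Projectivization K V, ∃ i, π X.submodule = H i X := by
    intro X
    obtain ⟨r, hr, hrs⟩ := exists_point_not_le (U := (s X).1) (W := π X.submodule) (by
      intro hle
      have := Submodule.finrank_mono hle
      rw [hG.finrank_eq X, (s X).2] at this
      omega)
    obtain ⟨i, hi⟩ := h.exists_le hι X r
    have h1 := finrank_sup_point hrs
    rw [(s X).2] at h1
    refine ⟨i, ?_⟩
    rw [← Submodule.eq_of_le_of_finrank_eq (sup_le (hsπ X) hr) (by rw [h1, hG.finrank_eq X]),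
      ← Submodule.eq_of_le_of_finrank_eq (sup_le ((h.isTangent_iff_le i X _ (hps X)).1 (hs X i)) hi)
        (by rw [h1, (h.isNullSystem i).finrank_eq X])]
  choose j hj using hex
  have hstep : ∀ X Y : Projectivization K V, Y.submodule ≤ π X.submodule →
      ¬ Y.submodule ≤ (s X).1 → j X = j Y := by
    intro X Y hYX hYs
    have hXY : X ≠ Y := by
      rintro rfl
      exact hYs (hps X)
    by_contra hne
    set ℓ : Line K V := ⟨_, finrank_join hXY⟩ with hℓ
    have hXℓ : X.submodule ≤ ℓ.1 := le_sup_left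
    have hYℓ : Y.submodule ≤ ℓ.1 := le_sup_right
    have h1 : ℓ ∈ commonTangents θ := by
      refine h.mem_commonTangents hι hV hne ?_ ?_
      · rw [h.isTangent_iff_le _ X ℓ hXℓ, ← hj]
        exact sup_le (hπ.absolute X) hYX
      · rw [h.isTangent_iff_le _ Y ℓ hYℓ, ← hj]
        exact sup_le (hπ.le_comm hYX) (hπ.absolute Y)
    exact hYs (h.eq_of_mem_commonTangents hι hV h1 (hs X) hXℓ (hps X) ▸ hYℓ)
  have hne : ∀ X Z : Projectivization K V, s X ≠ s Z → j X = j Z := by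
    intro X Z hXZ
    -- two different spread lines do not lie in a common plane
    have hplane : ∀ X Z : Projectivization K V, s X ≠ s Z → ¬ (s X).1 ≤ π Z.submodule := by
      intro X Z hXZ hle
      obtain ⟨p, hp, hp'⟩ := exists_common_point hle (hsπ Z)
        (by rw [hG.finrank_eq Z, (s X).2, (s Z).2]; omega)
      exact hXZ (h.eq_of_mem_commonTangents hι hV (hs X) (hs Z) hp hp')
    obtain ⟨p, hp, -⟩ := exists_point_not_le (U := ⊥) (W := π X.submodule ⊓ π Z.submodule) (by
      intro hle
      have h1 := two_le_finrank_inf hV (hG.finrank_eq X) (hG.finrank_eq Z)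
      rw [le_bot_iff.1 hle, finrank_bot] at h1
      omega)
    obtain ⟨m, hm, -, hmXZ⟩ := exists_line_through hp
      (two_le_finrank_inf hV (hG.finrank_eq X) (hG.finrank_eq Z))
    obtain ⟨Y, hYm, hYX, hYZ⟩ := exists_point_off_lines hq hm (s X).2 (s Z).2
      (fun h1 => hplane X Z hXZ (h1 ▸ hmXZ.trans inf_le_right))
      (fun h1 => hplane Z X hXZ.symm (h1 ▸ hmXZ.trans inf_le_left))
    exact (hstep X Y (hYm.trans (hmXZ.trans inf_le_left)) hYX).trans
      (hstep Z Y (hYm.trans (hmXZ.trans inf_le_right)) hYZ).symm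
  have hconst : ∀ X Z : Projectivization K V, j X = j Z := by
    intro X Z
    by_cases hXZ : s X = s Z
    · obtain ⟨Y, -, hY⟩ := exists_point_not_le (U := (s X).1) (W := ⊤) (by
        intro hle
        have := Submodule.finrank_mono hle
        rw [(s X).2, finrank_top] at this
        omega)
      have h1 : s X ≠ s Y := fun h1 => hY (h1 ▸ hps Y)
      exact (hne X Y h1).trans (hne Y Z (hXZ ▸ h1.symm))
    · exact hne X Z hXZ
  obtain ⟨X, -, -⟩ := exists_point_not_le (K := K) (V := V) (U := ⊥) (W := ⊤) (by
    intro hle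
    have := Submodule.finrank_mono hle
    rw [finrank_top, finrank_bot] at this
    omega)
  refine ⟨j X, Set.ext fun ℓ => ?_⟩
  obtain ⟨p, hp⟩ := ℓ.exists_point
  refine (h.isTangent_iff_le _ p ℓ hp).trans ?_
  rw [hconst X p, ← hj]
  exact (hπ.le_map_iff ℓ.2 hp).symm

end Complex

/-! ### Regularity of the spread -/

section Regular

variable {K V : Type*} [Field K] [AddCommGroup V] [Module K V]

theorem meets_iff {ℓ m : Line K V} :
    Meets ℓ m ↔ ∃ p : Projectivization K V, p.submodule ≤ ℓ.1 ∧ p.submodule ≤ m.1 :=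
  Iff.rfl

theorem meets_comm {ℓ m : Line K V} : Meets ℓ m ↔ Meets m ℓ := by
  rw [Meets, Set.inter_comm, Meets]

theorem Skew.not_meets {ℓ m : Line K V} (h : Skew ℓ m) : ¬ Meets ℓ m :=
  Set.not_nonempty_iff_eq_empty.2 (Set.disjoint_iff_inter_eq_empty.1 h)

/-- Two transversals of `b` and `c` through `X` would span the plane on `X` and `b` as well as the
plane on `X` and `c`, and then `b` and `c` would meet. -/
theorem transversal_unique [FiniteDimensional K V] {b c t u : Line K V} (hbc : Skew b c)
    {X : Projectivization K V} (hXb : ¬ X.submodule ≤ b.1) (hXc : ¬ X.submodule ≤ c.1)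
    (hXt : X.submodule ≤ t.1) (hXu : X.submodule ≤ u.1) (htb : Meets t b) (htc : Meets t c)
    (hub : Meets u b) (huc : Meets u c) : t = u := by
  by_contra hne
  have hplane : ∀ b : Line K V, ¬ X.submodule ≤ b.1 → Meets t b → Meets u b →
      b.1 ≤ t.1 ⊔ u.1 := by
    intro b hXb htb hub
    have hle : ∀ t : Line K V, X.submodule ≤ t.1 → Meets t b → t.1 ≤ b.1 ⊔ X.submodule := by
      intro t hXt htb
      obtain ⟨p, hpt, hpb⟩ := meets_iff.1 htb
      have hXp : X ≠ p := by
        rintro rfl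
        exact hXb hpb
      rw [← join_eq hXp t.2 hXt hpt]
      exact sup_le le_sup_right (hpb.trans le_sup_left)
    rw [Submodule.eq_of_le_of_finrank_eq (sup_le (hle t hXt htb) (hle u hXu hub)) (by
      rw [finrank_sup_lines t.2 u.2 (fun h => hne (Subtype.ext h)) hXt hXu,
        finrank_sup_point hXb, b.2])]
    exact le_sup_left
  obtain ⟨p, hp, hp'⟩ := exists_common_point (hplane b hXb htb hub) (hplane c hXc htc huc) (by
    rw [finrank_sup_lines t.2 u.2 (fun h => hne (Subtype.ext h)) hXt hXu, b.2, c.2]; omega)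
  exact hbc.not_meets (meets_iff.2 ⟨p, hp, hp'⟩)

theorem ncard_transversals_le [Finite V] {a b c : Line K V} (hab : Skew a b)
    (hac : Skew a c) (hbc : Skew b c) :
    {t : Line K V | Meets t a ∧ Meets t b ∧ Meets t c}.ncard ≤ Nat.card K + 1 := by
  have hex : ∀ t : Line K V, ∃ p : Projectivization K V,
      Meets t a → p.submodule ≤ t.1 ∧ p.submodule ≤ a.1 := by
    intro t
    by_cases ht : Meets t a
    · obtain ⟨p, hp⟩ := meets_iff.1 ht
      exact ⟨p, fun _ => hp⟩
    · obtain ⟨p, -⟩ := t.exists_point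
      exact ⟨p, fun h => absurd h ht⟩
  choose f hf using hex
  have h1 := count_univ_line (K := K) a.2
  rw [count, Set.univ_inter] at h1
  rw [← h1]
  refine Set.ncard_le_ncard_of_injOn f (fun t ht => (hf t ht.1).2) ?_ (Set.toFinite _)
  intro t ht u hu htu
  obtain ⟨t1, t2⟩ := hf t ht.1
  obtain ⟨u1, u2⟩ := hf u hu.1
  rw [← htu] at u1
  exact transversal_unique hbc (fun h => hab.not_meets (meets_iff.2 ⟨_, t2, h⟩))
    (fun h => hac.not_meets (meets_iff.2 ⟨_, t2, h⟩)) t1 u1 ht.2.1 ht.2.2 hu.2.1 hu.2.2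

variable [Finite V] [Finite K] {ι : Type*} [Finite ι]
  {θ : ι → Set (Projectivization K V)} {H : ι → Projectivization K V → Submodule K V}

/-- Let `t` be a transversal of three spread lines. The polars of `t` in the `q + 1` complexes are
again transversals, and they are different, so they are all the transversals. The spread line on a
point `Z` of `t` lies in the plane `H i Z`, which contains the polar of `t` in the `i`-th complex,
so it meets this polar. -/
theorem IsTangentSystem.meets_transversal (h : IsTangentSystem θ H)
    (hι : Nat.card ι = Nat.card K + 1) (hV : Module.finrank K V = 4) {a b c : Line K V}
    (ha : a ∈ commonTangents θ) (hb : b ∈ commonTangents θ) (hc : c ∈ commonTangents θ)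
    (hab : Skew a b) (hac : Skew a c) (hbc : Skew b c) {t u z : Line K V}
    (ht : Meets t a ∧ Meets t b ∧ Meets t c) (hu : Meets u a ∧ Meets u b ∧ Meets u c)
    (hz : z ∈ commonTangents θ) {Z : Projectivization K V} (hZt : Z.submodule ≤ t.1)
    (hZz : Z.submodule ≤ z.1) : Meets z u := by
  have hfin : ∀ i, Module.finrank K (perp (H i) t.1) = 2 := by
    intro i
    have h1 := (h.isNullSystem i).finrank_perp hV t.1
    rw [t.2] at h1
    omega
  have hmeet : ∀ (i : ι) (a : Line K V) (X : Projectivization K V), a ∈ commonTangents θ →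
      X.submodule ≤ t.1 → X.submodule ≤ a.1 → Meets a ⟨perp (H i) t.1, hfin i⟩ := by
    intro i a X ha hXt hXa
    exact meets_iff.2 (exists_common_point ((h.isTangent_iff_le i X a hXa).1 (ha i))
      (le_perp_iff.1 le_rfl X hXt)
      (by rw [(h.isNullSystem i).finrank_eq, a.2, hfin i]; omega))
  set T : Set (Line K V) := {t | Meets t a ∧ Meets t b ∧ Meets t c} with hT
  have hmaps : ∀ i, (⟨perp (H i) t.1, hfin i⟩ : Line K V) ∈ T := by
    intro i
    have key : ∀ a : Line K V, a ∈ commonTangents θ → Meets t a →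
        Meets ⟨perp (H i) t.1, hfin i⟩ a := by
      intro a ha hta
      obtain ⟨X, hXt, hXa⟩ := meets_iff.1 hta
      exact meets_comm.1 (hmeet i a X ha hXt hXa)
    exact ⟨key a ha ht.1, key b hb ht.2.1, key c hc ht.2.2⟩
  have hinj : Function.Injective fun i => (⟨perp (H i) t.1, hfin i⟩ : Line K V) := by
    intro i j hij
    by_contra hne
    obtain ⟨X, hXt, hXa⟩ := meets_iff.1 ht.1
    by_cases hX : X.submodule ≤ perp (H i) t.1
    · -- the polar is `t` itself, which is then a line of the spread that meets `a` and `b`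
      have e1 : (⟨perp (H i) t.1, hfin i⟩ : Line K V) = t :=
        transversal_unique hbc (fun h1 => hab.not_meets (meets_iff.2 ⟨_, hXa, h1⟩))
          (fun h1 => hac.not_meets (meets_iff.2 ⟨_, hXa, h1⟩)) hX hXt (hmaps i).2.1
          (hmaps i).2.2 ht.2.1 ht.2.2
      have htan : ∀ k, (⟨perp (H k) t.1, hfin k⟩ : Line K V) = t → IsTangent t (θ k) := by
        intro k hk
        rw [h.isTangent_iff_le k X t hXt]
        exact (congrArg Subtype.val hk).ge.trans (le_perp_iff.1 le_rfl X hXt)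
      have htS := h.mem_commonTangents hι hV hne (htan i e1) (htan j (hij.symm.trans e1))
      obtain ⟨Y, hYt, hYb⟩ := meets_iff.1 ht.2.1
      have e2 := h.eq_of_mem_commonTangents hι hV htS ha hXt hXa
      exact hab.not_meets (meets_iff.2 ⟨Y, e2 ▸ hYt, hYb⟩)
    · have h1 : ∀ k, perp (H k) t.1 = perp (H i) t.1 →
          perp (H i) t.1 ⊔ X.submodule = H k X := by
        intro k hk
        refine Submodule.eq_of_le_of_finrank_eq (sup_le ?_ ((h.isNullSystem k).self_le X)) ?_
        · rw [← hk]
          exact le_perp_iff.1 le_rfl X hXt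
        · rw [finrank_sup_point hX, hfin i, (h.isNullSystem k).finrank_eq]
      exact h.ne hι hV hne X ((h1 i rfl).symm.trans (h1 j (congrArg Subtype.val hij).symm))
  have hrange : Set.range (fun i => (⟨perp (H i) t.1, hfin i⟩ : Line K V)) = T := by
    refine Set.eq_of_subset_of_ncard_le (Set.range_subset_iff.2 hmaps) ?_ (Set.toFinite _)
    rw [← Set.image_univ, hinj.injOn.ncard_image, Set.ncard_univ, hι]
    exact ncard_transversals_le hab hac hbc
  obtain ⟨i, rfl⟩ : u ∈ Set.range (fun i => (⟨perp (H i) t.1, hfin i⟩ : Line K V)) :=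
    hrange ▸ hu
  exact hmeet i z Z hz hZt hZz

theorem IsTangentSystem.isRegularSpread (h : IsTangentSystem θ H)
    (hι : Nat.card ι = Nat.card K + 1) (hV : Module.finrank K V = 4)
    (hcard : ∀ i, (θ i).ncard = Nat.card K ^ 2 + 1) : IsRegularSpread (commonTangents θ) := by
  have hS := h.isSpread_commonTangents hι hV hcard
  refine ⟨hS, ?_⟩
  rintro a ha b hb c hc hab hac hbc _ ⟨a', b', c', hab', hac', hbc', rfl⟩ haR hbR hcR r hr
  obtain ⟨Z, hZr, hZa'⟩ := meets_iff.1 hr.1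
  obtain ⟨z, hz, hZz⟩ := h.exists_mem_commonTangents hι hV Z
  have ha' : Meets a' a ∧ Meets a' b ∧ Meets a' c :=
    ⟨meets_comm.1 haR.1, meets_comm.1 hbR.1, meets_comm.1 hcR.1⟩
  have hmeet : ∀ u : Line K V, Meets u a ∧ Meets u b ∧ Meets u c → Meets z u := fun u hu =>
    h.meets_transversal hι hV ha hb hc (hS.2 a ha b hb hab) (hS.2 a ha c hc hac)
      (hS.2 b hb c hc hbc) ha' hu hz hZa' hZz
  have hzr : z = r := transversal_unique hbc'
    (fun h1 => hab'.not_meets (meets_iff.2 ⟨_, hZa', h1⟩))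
    (fun h1 => hac'.not_meets (meets_iff.2 ⟨_, hZa', h1⟩)) hZz hZr
    (hmeet b' ⟨meets_comm.1 haR.2.1, meets_comm.1 hbR.2.1, meets_comm.1 hcR.2.1⟩)
    (hmeet c' ⟨meets_comm.1 haR.2.2, meets_comm.1 hbR.2.2, meets_comm.1 hcR.2.2⟩)
    hr.2.1 hr.2.2
  exact hzr ▸ hz

end Regular

/-! ### Lines outside the spread -/

section Counting

variable {K V : Type*} [Field K] [AddCommGroup V] [Module K V] [Finite V] [Finite K]

theorem IsOvoidalFibration.ncard_secant_disjoint
    {θ : Fin (Nat.card K + 1) → Set (Projectivization K V)} (hθ : IsOvoidalFibration θ)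
    {ℓ : Line K V} (hℓ : ∃! i, IsTangent ℓ (θ i)) :
    {j | IsSecant ℓ (θ j)}.ncard = Nat.card K / 2 ∧
      {k | Disjoint ℓ.points (θ k)}.ncard = Nat.card K / 2 := by
  classical
  obtain ⟨i, hi, huniq⟩ := hℓ
  have hcases : ∀ j, count (θ j) ℓ.1 = 0 ∨ count (θ j) ℓ.1 = 1 ∨ count (θ j) ℓ.1 = 2 := by
    intro j
    have := (hθ.isOvoid j).isCap ℓ.1 ℓ.2
    omega
  have htan : {j | count (θ j) ℓ.1 = 1} = {i} := by
    ext j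
    exact ⟨fun hj => huniq j (isTangent_iff.2 hj), fun hj => hj ▸ isTangent_iff.1 hi⟩
  have hsum := hθ.sum_count ℓ
  have hsplit : ∀ j, count (θ j) ℓ.1 =
      (if count (θ j) ℓ.1 = 1 then 1 else 0) + 2 * (if count (θ j) ℓ.1 = 2 then 1 else 0) := by
    intro j
    rcases hcases j with h | h | h <;> simp [h]
  have hone : ∀ j, 1 = (if count (θ j) ℓ.1 = 0 then 1 else 0) +
      (if count (θ j) ℓ.1 = 1 then 1 else 0) + (if count (θ j) ℓ.1 = 2 then 1 else 0) := by
    intro j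
    rcases hcases j with h | h | h <;> simp [h]
  have hncard : ∀ n : ℕ, ∑ j, (if count (θ j) ℓ.1 = n then 1 else 0) =
      {j | count (θ j) ℓ.1 = n}.ncard := by
    intro n
    rw [Finset.sum_boole, ← Set.ncard_coe_finset]
    simp
  rw [Finset.sum_congr rfl fun j _ => hsplit j, Finset.sum_add_distrib, ← Finset.mul_sum,
    hncard, hncard, htan, Set.ncard_singleton] at hsum
  have htotal : ∑ _j : Fin (Nat.card K + 1), 1 = Nat.card K + 1 := by simp
  rw [Finset.sum_congr rfl fun j _ => hone j, Finset.sum_add_distrib, Finset.sum_add_distrib,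
    hncard, hncard, hncard, htan, Set.ncard_singleton] at htotal
  simp only [isSecant_iff, disjoint_iff_count]
  omega

end Counting

end PG3

open PG3
theorem proposition1 {K V : Type*} [Field K] [AddCommGroup V] [Module K V]
    (hV : Module.finrank K V = 4)
    (n : ℕ) (hq : Nat.card K = 2 ^ n) (hq2 : 2 < Nat.card K)
    (θ : Fin (Nat.card K + 1) → Set (Projectivization K V))
    (hθ : IsOvoidalFibration θ) :
    -- (i)
    IsRegularSpread (commonTangents θ) ∧
    {L : Set (Line K V) | IsGeneralLinearComplex L ∧ commonTangents θ ⊆ L} =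
      Set.range (fun i => tangentLines (θ i)) ∧
    (∀ i j, i ≠ j → tangentLines (θ i) ∩ tangentLines (θ j) = commonTangents θ) ∧
    -- (ii)
    (∀ ℓ : Line K V, ℓ ∉ commonTangents θ →
      (∃! i, IsTangent ℓ (θ i)) ∧
      {j | IsSecant ℓ (θ j)}.ncard = Nat.card K / 2 ∧
      {k | Disjoint ℓ.points (θ k)}.ncard = Nat.card K / 2) := by
  have : Finite K := Nat.finite_of_card_ne_zero (by omega)
  have : FiniteDimensional K V := Module.finite_of_finrank_pos (by omega)
  have : Finite V := Module.finite_of_finite K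
  have heven : Even (Nat.card K) := by
    rw [hq]
    refine (even_two).pow_of_ne_zero ?_
    rintro rfl
    omega
  have hι : Nat.card (Fin (Nat.card K + 1)) = Nat.card K + 1 := Nat.card_fin _
  obtain ⟨H, h⟩ := hθ.exists_isTangentSystem hV heven hq2
  refine ⟨h.isRegularSpread hι hV fun i => (hθ.isOvoid i).1, Set.ext fun L => ⟨?_, ?_⟩, ?_, ?_⟩
  · rintro ⟨hL, hSL⟩
    exact h.eq_tangentLines hι hV hq2.le hL hSL
  · rintro ⟨i, rfl⟩
    exact ⟨h.isGeneralLinearComplex hV i, fun ℓ hℓ => hℓ i⟩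
  · intro i j hij
    exact Set.Subset.antisymm (fun ℓ hℓ => h.mem_commonTangents hι hV hij hℓ.1 hℓ.2)
      fun ℓ hℓ => ⟨hℓ i, hℓ j⟩
  · intro ℓ hℓ
    have huniq : ∃! i, IsTangent ℓ (θ i) := by
      obtain ⟨i, hi⟩ := h.exists_isTangent ℓ
      refine ⟨i, hi, fun j hj => ?_⟩
      by_contra hne
      exact hℓ (h.mem_commonTangents hι hV hne hj hi)
    exact ⟨huniq, hθ.ncard_secant_disjoint huniq⟩
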